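/- Let $\mathbb{K}$ be a field of characteristic zero. **Quasi-posets.** A quasi-poset $P=(A,\le_P)$ is a finite set $A$ with a reflexive and transitive relation; $x\sim_P y$ means $x\le_P y$ and $y\le_P x$. The quotient $\overline P=A/{\sim_P}$ is a poset, and $cl(P)$ is its cardinality. The open sets of $P$ are the subsets $O$ such that $i\in O$ and $i\le_P j$ imply $j\in O$; $cc(P)$ is the number of connected components of this topology. $P$ is discrete if $\le_P$ equals $\sim_P$. $\mu_P$ is the number of order-preserving bijections from $\overline P$ to $\{1,\dots,cl(P)\}$. For $B\subseteq A$, $P_{|B}$ is the restriction of $P$ to $B$. For an equivalence $\sim$ on $A$, $P|{\sim}$ is the quasi-order on $A$ given by ($x\le_P y$ and $x\sim y$), and $P/{\sim}$ is the transitive closure of the relation ($x\le_P y$ or $x\sim y$). We write $\sim\,\triangleleft P$ if the restriction of $P$ to every class of $\sim$ is connected and $\sim_{P/\sim}$ is equal to $\sim$. **Ehrhart polynomials.** $ehr_P, ehr_P^{str}\in\mathbb{Q}[X]$ are the unique polynomials such that, for all $k\ge 0$, $ehr_P(k)$ is the number of maps $f:A\to\{1,\dots,k\}$ with $i\le_P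 j\Rightarrow f(i)\le f(j)$, and $ehr^{str}_P(k)$ is the number of those maps which moreover satisfy: $i\le_P j$ and $f(i)=f(j)$ imply $i\sim_P j$. **Algebra.** $\mathcal{H}_{\mathbf{qp}}$ is the $\mathbb{K}$-vector space with basis the isoclasses of quasi-posets, with product the disjoint union and the coproducts $$\Delta(P)=\sum_{O\text{ open}}P_{|A\setminus O}\otimes P_{|O},\qquad \delta(P)=\sum_{\sim\triangleleft P}(P/{\sim})\otimes(P|{\sim}).$$ The counit of $\Delta$ sends the empty quasi-poset to $1$ and all others to $0$; the counit $\varepsilon'$ of $\delta$ sends discrete quasi-posets to $1$ and all others to $0$. $\mathcal{H}_{\mathbf{qp}}$ is graded by $cl$. $\mathbb{K}[X]$ has its usual product and grading, and the coproduct with $\Delta(X)=X\otimes1+1\otimes X$. $M_{\mathbf{qp}}$ is the monoid of algebra morphisms $\mathcal{H}_{\mathbf{qp}}\to\mathbb{K}$ with product $\chi*\chi'=(\chi\otimes\chi')\circ\delta$ and unit $\varepsilon'$. For an algebra morphism $\phi:\mathcal{H}_{\mathbf{qp}}\to\mathbb{K}[X]$ and $\chi\in M_{\mathbf{qp}}$,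 put $\phi\leftarrow\chi=(\phi\otimes\chi)\circ\delta$. Let $\phi_0$ be the unique homogeneous Hopf algebra morphism from $(\mathcal{H}_{\mathbf{qp}},m,\Delta)$ to $(\mathbb{K}[X],m,\Delta)$ that sends, for all $n\ge1$, the quasi-poset formed by $n$ equivalent elements to $X$. Let $\lambda\in M_{\mathbf{qp}}$ be the unique character with $\phi_0(P)=\lambda_PX^{cl(P)}$ for all $P$, and let $\alpha,\alpha^{str}\in M_{\mathbf{qp}}$ be the unique characters with $ehr=\phi_0\leftarrow\alpha$ and $ehr^{str}=\phi_0\leftarrow\alpha^{str}$. **Theorem.** The objects $\phi_0,\lambda,\alpha,\alpha^{str}$ exist and are unique as described, and: 1. (Duality principle) For any quasi-poset $P$, $ehr^{str}_P(X)=(-1)^{cl(P)}\,ehr_P(-X)$. 2. For any quasi-poset $P$, $\alpha_P=(-1)^{cl(P)+cc(P)}\,\alpha^{str}_P$. 3. $\alpha$ is invertible in $M_{\mathbf{qp}}$, its inverse $\beta$ is unique, and for any quasi-poset $P$, $$\beta_P=(-1)^{cl(P)+cc(P)}\lambda_P=(-1)^{cl(P)+cc(P)}\frac{\mu_P}{cl(P)!}.$$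 -/

import Mathlib

open Polynomial TensorProduct
open scoped Topology

universe u v

namespace QuasiPoset

/-! A quasi-poset is a finite type `A` with a quasi-order `P : Preorder A`.  Since several quasi-orders
on the same set occur, they are passed explicitly.  The field `lt` of `Preorder` plays no role. -/

section Basic

variable {A : Type u} {B : Type v}

/-- Two quasi-posets are isomorphic. -/
def Iso (P : Preorder A) (Q : Preorder B) : Prop :=
  ∃ e : A ≃ B, ∀ x y, P.le x y ↔ Q.le (e x) (e y)

theorem Iso.refl (P : Preorder A) : Iso P P := ⟨Equiv.refl A, fun _ _ => Iff.rfl⟩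

theorem Iso.symm {P : Preorder A} {Q : Preorder B} (h : Iso P Q) : Iso Q P := by
  obtain ⟨e, he⟩ := h
  exact ⟨e.symm, fun x y => by simp [he]⟩

theorem Iso.trans {C : Type*} {P : Preorder A} {Q : Preorder B} {R : Preorder C}
    (h : Iso P Q) (h' : Iso Q R) : Iso P R := by
  obtain ⟨e, he⟩ := h
  obtain ⟨f, hf⟩ := h'
  exact ⟨e.trans f, fun x y => by simp [he, hf]⟩

/-- The topology associated to a quasi-poset: the open sets are the upper sets. -/
abbrev top (P : Preorder A) : TopologicalSpace A := @Topology.upperSet A P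

/-- The number of classes of `∼_P`, that is the cardinality of the poset of classes. -/
noncomputable def cl (P : Preorder A) : ℕ := Nat.card (Antisymmetrization A P.le)

/-- The number of connected components of the associated topology. -/
noncomputable def cc (P : Preorder A) : ℕ := Nat.card (@ConnectedComponents A (top P))

/-- A quasi-poset is discrete if its quasi-order is symmetric, that is equal to `∼_P`. -/
def IsDiscrete (P : Preorder A) : Prop := ∀ x y, P.le x y → P.le y x

/-- The number of heap-orderings of the poset of classes of `P`: order-preserving bijections from
this poset to `{1, …, cl P}`. -/
noncomputable def heapOrderings (P : Preorder A) : ℕ :=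
  letI := P
  Nat.card {f : Antisymmetrization A (· ≤ ·) ≃ Fin (cl P) // ∀ x y, x ≤ y → f x ≤ f y}

/-- The restriction of a quasi-order to a subset. -/
abbrev restrict (P : Preorder A) (S : Set A) : Preorder S :=
  @Preorder.lift S A P Subtype.val

/-- The quasi-order `P | r`. -/
abbrev restrictRel (P : Preorder A) (r : Setoid A) : Preorder A where
  le x y := P.le x y ∧ r x y
  lt x y := (P.le x y ∧ r x y) ∧ ¬(P.le y x ∧ r y x)
  le_refl x := ⟨P.le_refl x, r.refl x⟩
  le_trans x y z h h' := ⟨P.le_trans x y z h.1 h'.1, r.trans h.2 h'.2⟩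

/-- The quasi-order `P / r`: the transitive closure of the union of `≤_P` and `r`. -/
abbrev contract (P : Preorder A) (r : Setoid A) : Preorder A where
  le := Relation.TransGen fun x y => P.le x y ∨ r x y
  lt x y := Relation.TransGen (fun x y => P.le x y ∨ r x y) x y ∧
    ¬Relation.TransGen (fun x y => P.le x y ∨ r x y) y x
  le_refl x := Relation.TransGen.single (Or.inl (P.le_refl x))
  le_trans _ _ _ h h' := Relation.TransGen.trans h h'

/-- `r` is `P`-compatible: every class of `r` is connected for the quasi-order induced by `P`,
and `∼_{P / r}` is equal to `r`. -/
structure Compatible (P : Preorder A) (r : Setoid A) : Prop where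
  connected : ∀ x : A, @ConnectedSpace {y | r x y} (top (restrict P {y | r x y}))
  eq_of_contract : ∀ x y, (contract P r).le x y → (contract P r).le y x → r x y

/-- The disjoint union of two quasi-posets. -/
abbrev disjointUnion (P : Preorder A) (Q : Preorder B) : Preorder (A ⊕ B) :=
  @Sum.instPreorderSum A B P Q

/-- The quasi-poset on `n` elements which are all equivalent. -/
abbrev block (n : ℕ) : Preorder (Fin n) where
  le _ _ := True
  lt _ _ := True ∧ ¬True
  le_refl _ := trivial
  le_trans _ _ _ _ _ := trivial

theorem Iso.restrict {P : Preorder A} {Q : Preorder B} (e : A ≃ B)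
    (he : ∀ x y, P.le x y ↔ Q.le (e x) (e y)) (S : Set A) (T : Set B)
    (hST : ∀ x, x ∈ S ↔ e x ∈ T) : Iso (restrict P S) (restrict Q T) :=
  ⟨e.subtypeEquiv hST, fun x y => he x y⟩

theorem Iso.disjointUnion {A' : Type*} {B' : Type*} {P : Preorder A} {Q : Preorder B}
    {P' : Preorder A'} {Q' : Preorder B'} (h : Iso P P') (h' : Iso Q Q') :
    Iso (disjointUnion P Q) (disjointUnion P' Q') := by
  obtain ⟨e, he⟩ := h
  obtain ⟨f, hf⟩ := h'
  refine ⟨Equiv.sumCongr e f, ?_⟩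
  rintro (x | x) (y | y)
  · exact Sum.liftRel_inl_inl.trans ((he x y).trans Sum.liftRel_inl_inl.symm)
  · exact iff_of_false Sum.not_liftRel_inl_inr Sum.not_liftRel_inl_inr
  · exact iff_of_false Sum.not_liftRel_inr_inl Sum.not_liftRel_inr_inl
  · exact Sum.liftRel_inr_inr.trans ((hf x y).trans Sum.liftRel_inr_inr.symm)

theorem Iso.isDiscrete {P : Preorder A} {Q : Preorder B} (h : Iso P Q) (hP : IsDiscrete P) :
    IsDiscrete Q := by
  obtain ⟨e, he⟩ := h
  intro x y hxy
  have := hP (e.symm x) (e.symm y)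
  simp only [he, Equiv.apply_symm_apply] at this
  exact this hxy

theorem connectedSpace_of_iso {P : Preorder A} {Q : Preorder B} (h : Iso P Q)
    (hP : @ConnectedSpace A (top P)) : @ConnectedSpace B (top Q) := by
  obtain ⟨e, he⟩ := h
  let := top P
  let := top Q
  refine e.surjective.connectedSpace ?_
  refine ⟨fun s hs => ?_⟩
  intro x y hxy hx
  exact hs ((he x y).1 hxy) hx

theorem contract_le_map {P : Preorder A} {Q : Preorder B} (e : A ≃ B)
    (he : ∀ x y, P.le x y ↔ Q.le (e x) (e y)) (r : Setoid A) (s : Setoid B)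
    (hrs : ∀ x y, r x y ↔ s (e x) (e y)) (x y : A) :
    (contract P r).le x y ↔ (contract Q s).le (e x) (e y) := by
  constructor
  · intro h
    refine Relation.TransGen.lift (p := fun x y => Q.le x y ∨ s x y) e ?_ x y h
    intro a b hab
    exact hab.imp (he a b).1 (hrs a b).1
  · intro h
    have := Relation.TransGen.lift (r := fun x y => Q.le x y ∨ s x y)
      (p := fun x y => P.le x y ∨ r x y) e.symm (fun a b hab => by
        simpa only [Function.onFun, he, hrs, Equiv.apply_symm_apply] using hab) _ _ h
    simp only [Function.onFun] at this
    rwa [e.symm_apply_apply, e.symm_apply_apply] at this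

theorem Compatible.map {P : Preorder A} {Q : Preorder B} (e : A ≃ B)
    (he : ∀ x y, P.le x y ↔ Q.le (e x) (e y)) (r : Setoid A) (s : Setoid B)
    (hrs : ∀ x y, r x y ↔ s (e x) (e y)) (h : Compatible P r) : Compatible Q s := by
  constructor
  · intro x
    refine connectedSpace_of_iso ?_ (h.connected (e.symm x))
    refine Iso.restrict e he _ _ fun y => ?_
    simp [hrs]
  · intro x y hxy hyx
    obtain ⟨x, rfl⟩ := e.surjective x
    obtain ⟨y, rfl⟩ := e.surjective y
    rw [← hrs]
    exact h.eq_of_contract x y ((contract_le_map e he r s hrs x y).2 hxy)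
      ((contract_le_map e he r s hrs y x).2 hyx)

end Basic

/-! ### Ehrhart polynomials -/

section Ehrhart

variable {A : Type u} {B : Type v}

/-- `L_P(k)`, with `{1, …, k}` replaced by `Fin k`. -/
def L (P : Preorder A) (k : ℕ) : Set (A → Fin k) :=
  {f | ∀ i j, P.le i j → f i ≤ f j}

/-- `L^str_P(k)`. -/
def LStr (P : Preorder A) (k : ℕ) : Set (A → Fin k) :=
  {f | f ∈ L P k ∧ ∀ i j, P.le i j → f i = f j → P.le j i}

theorem exists_poly_of_maps [Finite A] (S : ∀ k : ℕ, Set (A → Fin k))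
    (hS : ∀ i k (g : Fin i ↪o Fin k) (w : A → Fin i), g ∘ w ∈ S k ↔ w ∈ S i) :
    ∃ p : ℚ[X], ∀ k : ℕ, p.eval (k : ℚ) = (S k).ncard := by
  classical
  have := Fintype.ofFinite A
  set W : ℕ → ℕ := fun i => Nat.card {w : A → Fin i // w ∈ S i ∧ Function.Surjective w} with hW
  have hW0 : ∀ i, Fintype.card A < i → W i = 0 := by
    intro i hi
    have : IsEmpty {w : A → Fin i // w ∈ S i ∧ Function.Surjective w} := by
      refine ⟨fun w => ?_⟩
      have := Fintype.card_le_of_surjective _ w.2.2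
      simp at this
      omega
    simp [hW]
  have hT : ∀ (k : ℕ) (T : Finset (Fin k)),
      Nat.card {f : A → Fin k // f ∈ S k ∧ Finset.univ.image f = T} = W T.card := by
    intro k T
    refine (Nat.card_congr (Equiv.ofBijective
      (fun w : {w : A → Fin T.card // w ∈ S T.card ∧ Function.Surjective w} =>
        (⟨T.orderEmbOfFin rfl ∘ w.1, (hS _ _ _ _).2 w.2.1, ?_⟩ :
          {f : A → Fin k // f ∈ S k ∧ Finset.univ.image f = T})) ⟨?_, ?_⟩)).symm
    · rw [← Finset.image_image, Finset.image_univ_of_surjective w.2.2,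
        Finset.image_orderEmbOfFin_univ]
    · intro w w' h
      have h1 := congrArg Subtype.val h
      exact Subtype.ext ((T.orderEmbOfFin rfl).injective.comp_left h1)
    · rintro ⟨f, hf, hfT⟩
      have hmem : ∀ a, ∃ i, T.orderEmbOfFin rfl i = f a := by
        intro a
        have : f a ∈ (T : Set (Fin k)) := by
          rw [← hfT]; simp
        rwa [← Finset.range_orderEmbOfFin T rfl] at this
      choose w hw using hmem
      have hwf : T.orderEmbOfFin rfl ∘ w = f := funext hw
      refine ⟨⟨w, (hS _ _ (T.orderEmbOfFin rfl) w).1 (hwf ▸ hf), ?_⟩, Subtype.ext hwf⟩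
      intro i
      have hi : T.orderEmbOfFin rfl i ∈ T := Finset.orderEmbOfFin_mem T rfl i
      obtain ⟨a, -, ha⟩ := Finset.mem_image.1 (hfT.ge hi)
      exact ⟨a, (T.orderEmbOfFin rfl).injective ((hw a).trans ha)⟩
  have hcard : ∀ k : ℕ, (S k).ncard = ∑ i ∈ Finset.range (k + 1), k.choose i * W i := by
    intro k
    have h1 : (S k).ncard = ∑ T : Finset (Fin k),
        Nat.card {f : A → Fin k // f ∈ S k ∧ Finset.univ.image f = T} := by
      rw [← Nat.card_coe_set_eq, ← Nat.card_sigma]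
      refine Nat.card_congr ⟨fun f => ⟨Finset.univ.image f.1, f.1, f.2, rfl⟩,
        fun x => ⟨x.2.1, x.2.2.1⟩, fun _ => rfl, ?_⟩
      rintro ⟨T, f, hf, rfl⟩
      rfl
    rw [h1, Finset.sum_congr rfl fun T _ => hT k T, ← Finset.powerset_univ,
      Finset.sum_powerset_apply_card]
    simp
  refine ⟨∑ i ∈ Finset.range (Fintype.card A + 1),
    C ((W i : ℚ) / (i.factorial : ℚ)) * descPochhammer ℚ i, fun k => ?_⟩
  have h2 : ∀ i : ℕ, (C ((W i : ℚ) / (i.factorial : ℚ)) * descPochhammer ℚ i).eval (k : ℚ)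
      = ((k.choose i * W i : ℕ) : ℚ) := by
    intro i
    rw [eval_mul, eval_C, descPochhammer_eval_eq_descFactorial, Nat.descFactorial_eq_factorial_mul_choose]
    have : (i.factorial : ℚ) ≠ 0 := by positivity
    push_cast
    field_simp
  rw [eval_finsetSum, Finset.sum_congr rfl fun i _ => h2 i, hcard, ← Nat.cast_sum]
  congr 1
  rcases le_total k (Fintype.card A) with h | h
  · refine (Finset.sum_subset (Finset.range_mono (by omega)) ?_).symm
    intro i _ hi
    rw [Nat.choose_eq_zero_of_lt (by simpa using hi), zero_mul]
  · refine Finset.sum_subset (Finset.range_mono (by omega)) ?_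
    intro i _ hi
    rw [hW0 i (by simpa using hi), mul_zero]

theorem exists_ehr [Finite A] (P : Preorder A) :
    ∃ p : ℚ[X], ∀ k : ℕ, p.eval (k : ℚ) = (L P k).ncard := by
  refine exists_poly_of_maps (L P) fun i k g w => ?_
  simp [L]

theorem exists_ehrStr [Finite A] (P : Preorder A) :
    ∃ p : ℚ[X], ∀ k : ℕ, p.eval (k : ℚ) = (LStr P k).ncard := by
  refine exists_poly_of_maps (LStr P) fun i k g w => ?_
  simp [LStr, L]

/-- The Ehrhart polynomial: the polynomial with `ehr P (k) = # L_P(k)` for all `k`. -/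
noncomputable def ehr [Finite A] (P : Preorder A) : ℚ[X] := (exists_ehr P).choose

/-- The strict Ehrhart polynomial: the polynomial with `ehrStr P (k) = # L^str_P(k)` for all `k`. -/
noncomputable def ehrStr [Finite A] (P : Preorder A) : ℚ[X] := (exists_ehrStr P).choose

theorem ehr_eval [Finite A] (P : Preorder A) (k : ℕ) : (ehr P).eval (k : ℚ) = (L P k).ncard :=
  (exists_ehr P).choose_spec k

theorem ehrStr_eval [Finite A] (P : Preorder A) (k : ℕ) :
    (ehrStr P).eval (k : ℚ) = (LStr P k).ncard :=
  (exists_ehrStr P).choose_spec k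

theorem poly_eq_of_nat {p q : ℚ[X]} (h : ∀ k : ℕ, p.eval (k : ℚ) = q.eval (k : ℚ)) : p = q := by
  refine eq_of_infinite_eval_eq p q ?_
  refine (Set.infinite_range_of_injective (Nat.cast_injective (R := ℚ))).mono ?_
  rintro _ ⟨k, rfl⟩
  exact h k

theorem ehr_congr [Finite A] [Finite B] {P : Preorder A} {Q : Preorder B} (h : Iso P Q) :
    ehr P = ehr Q := by
  obtain ⟨e, he⟩ := h
  refine poly_eq_of_nat fun k => ?_
  rw [ehr_eval, ehr_eval, ← Nat.card_coe_set_eq, ← Nat.card_coe_set_eq]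
  congr 1
  refine Nat.card_congr ((e.arrowCongr (Equiv.refl (Fin k))).subtypeEquiv fun f => ?_)
  simp only [L, Set.mem_ofPred_eq, he, Equiv.arrowCongr_apply, Function.comp, Equiv.refl_apply]
  rw [← e.forall_congr_right]
  refine forall_congr' fun i => ?_
  rw [← e.forall_congr_right]
  simp

theorem ehrStr_congr [Finite A] [Finite B] {P : Preorder A} {Q : Preorder B} (h : Iso P Q) :
    ehrStr P = ehrStr Q := by
  obtain ⟨e, he⟩ := h
  refine poly_eq_of_nat fun k => ?_
  rw [ehrStr_eval, ehrStr_eval, ← Nat.card_coe_set_eq, ← Nat.card_coe_set_eq]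
  congr 1
  refine Nat.card_congr ((e.arrowCongr (Equiv.refl (Fin k))).subtypeEquiv fun f => ?_)
  simp only [LStr, L, Set.mem_ofPred_eq, he, Equiv.arrowCongr_apply, Function.comp,
    Equiv.refl_apply, e.forall_congr_left, Equiv.apply_symm_apply]

end Ehrhart

/-! ### Isoclasses of quasi-posets, and the vector space they generate -/

/-- Isomorphism of quasi-posets with underlying sets `{1, …, n}`, `n ≥ 0`. -/
def isoSetoid : Setoid (Σ n : ℕ, Preorder (Fin n)) where
  r P Q := Iso P.2 Q.2
  iseqv := ⟨fun P => Iso.refl P.2, Iso.symm, Iso.trans⟩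

/-- The set of isoclasses of quasi-posets. -/
def Qp : Type := Quotient isoSetoid

section Isoclass

variable {A : Type u} {B : Type v}

/-- The isoclass of a quasi-poset. -/
noncomputable def isoclass [Finite A] (P : Preorder A) : Qp :=
  Quotient.mk isoSetoid ⟨Nat.card A, @Preorder.lift _ _ P (Finite.equivFin A).symm⟩

theorem isoclass_fin {n : ℕ} (P : Preorder (Fin n)) :
    isoclass P = Quotient.mk isoSetoid ⟨n, P⟩ :=
  Quotient.sound (s := isoSetoid) ⟨(Finite.equivFin (Fin n)).symm, fun _ _ => Iff.rfl⟩

theorem isoclass_eq_iff [Finite A] [Finite B] {P : Preorder A} {Q : Preorder B} :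
    isoclass P = isoclass Q ↔ Iso P Q := by
  have key : ∀ {C : Type _} [Finite C] (R : Preorder C),
      Iso (@Preorder.lift _ _ R (Finite.equivFin C).symm) R :=
    fun {C} _ R => ⟨(Finite.equivFin C).symm, fun _ _ => Iff.rfl⟩
  have key' : ∀ {C : Type _} [Finite C] (R : Preorder C),
      Iso (@Preorder.lift _ _ R (Finite.equivFin C).symm) R :=
    fun {C} _ R => ⟨(Finite.equivFin C).symm, fun _ _ => Iff.rfl⟩
  constructor
  · intro h
    have h' : Iso _ _ := Quotient.exact (s := isoSetoid) h
    exact (key P).symm.trans (h'.trans (key' Q))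
  · intro h
    exact Quotient.sound (s := isoSetoid) ((key P).trans (h.trans (key' Q).symm))

theorem Qp.ind {motive : Qp → Prop} (h : ∀ (n : ℕ) (P : Preorder (Fin n)), motive (isoclass P))
    (q : Qp) : motive q := by
  refine Quotient.inductionOn q ?_
  rintro ⟨n, P⟩
  have := h n P
  rwa [isoclass_fin] at this

/-- A function on isoclasses, given by an isomorphism-invariant function. -/
def Qp.lift {β : Type*} (F : ∀ n : ℕ, Preorder (Fin n) → β)
    (hF : ∀ n m (P : Preorder (Fin n)) (Q : Preorder (Fin m)), Iso P Q → F n P = F m Q) : Qp → β :=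
  Quotient.lift (fun x => F x.1 x.2) fun x y h => hF x.1 y.1 x.2 y.2 h

theorem exists_fin_iso [Finite A] (P : Preorder A) :
    ∃ (n : ℕ) (Q : Preorder (Fin n)), Iso P Q :=
  ⟨_, @Preorder.lift _ _ P (Finite.equivFin A).symm,
    Iso.symm ⟨(Finite.equivFin A).symm, fun _ _ => Iff.rfl⟩⟩

theorem Qp.lift_fin {β : Type*} (F : ∀ n : ℕ, Preorder (Fin n) → β)
    (hF : ∀ n m (P : Preorder (Fin n)) (Q : Preorder (Fin m)), Iso P Q → F n P = F m Q)
    {n : ℕ} (P : Preorder (Fin n)) : Qp.lift F hF (isoclass P) = F n P := by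
  rw [isoclass_fin]; rfl

/-- The product of isoclasses is the disjoint union. -/
noncomputable instance : Mul Qp :=
  ⟨Quotient.lift₂ (fun x y => isoclass (disjointUnion x.2 y.2)) fun _ _ _ _ h h' =>
    isoclass_eq_iff.2 (Iso.disjointUnion h h')⟩

/-- The unit is the isoclass of the empty quasi-poset. -/
noncomputable instance : One Qp := ⟨isoclass (block 0)⟩

theorem isoclass_mul [Finite A] [Finite B] (P : Preorder A) (Q : Preorder B) :
    isoclass P * isoclass Q = isoclass (disjointUnion P Q) := by
  obtain ⟨n, P', hP⟩ := exists_fin_iso P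
  obtain ⟨m, Q', hQ⟩ := exists_fin_iso Q
  rw [isoclass_eq_iff.2 hP, isoclass_eq_iff.2 hQ, isoclass_eq_iff.2 (Iso.disjointUnion hP hQ),
    isoclass_fin, isoclass_fin]
  rfl

theorem one_eq_isoclass : (1 : Qp) = isoclass (block 0) := rfl

noncomputable instance : CommMonoid Qp where
  mul_assoc a b c := by
    induction a using Qp.ind with | h n P
    induction b using Qp.ind with | h m Q
    induction c using Qp.ind with | h l R
    rw [isoclass_mul, isoclass_mul, isoclass_mul, isoclass_mul, isoclass_eq_iff]
    refine ⟨Equiv.sumAssoc _ _ _, ?_⟩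
    rintro ((x | x) | x) ((y | y) | y) <;>
      simp
  mul_comm a b := by
    induction a using Qp.ind with | h n P
    induction b using Qp.ind with | h m Q
    rw [isoclass_mul, isoclass_mul, isoclass_eq_iff]
    refine ⟨Equiv.sumComm _ _, ?_⟩
    rintro (x | x) (y | y) <;> simp
  one_mul a := by
    induction a using Qp.ind with | h n P
    rw [one_eq_isoclass, isoclass_mul, isoclass_eq_iff]
    refine ⟨Equiv.emptySum _ _, ?_⟩
    rintro (x | x) (y | y)
    · exact x.elim0
    · exact x.elim0
    · exact y.elim0
    · simp
  mul_one a := by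
    induction a using Qp.ind with | h n P
    rw [one_eq_isoclass, isoclass_mul, isoclass_eq_iff]
    refine ⟨Equiv.sumEmpty _ _, ?_⟩
    rintro (x | x) (y | y)
    · simp
    · exact y.elim0
    · exact x.elim0
    · exact x.elim0

end Isoclass

section Hopf

variable (K : Type u) [Field K]

/-- The algebra `H_qp`: the vector space generated by isoclasses of quasi-posets, the product being
induced by the disjoint union. -/
abbrev Hqp : Type u := MonoidAlgebra K Qp

/-- The linear map on `H_qp` with given values on isoclasses. -/
noncomputable def linearLift {M : Type*} [AddCommGroup M] [Module K M] (F : Qp → M) :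
    Hqp K →ₗ[K] M :=
  Finsupp.linearCombination K F ∘ₗ (MonoidAlgebra.coeffLinearEquiv K).toLinearMap

/-- The basis element of `H_qp` given by a quasi-poset. -/
noncomputable def cls {A : Type v} [Finite A] (P : Preorder A) : Hqp K :=
  MonoidAlgebra.of K Qp (isoclass P)

theorem linearLift_cls {M : Type*} [AddCommGroup M] [Module K M]
    (F : Qp → M) {A : Type v} [Finite A] (P : Preorder A) :
    linearLift K F (cls K P) = F (isoclass P) := by
  simp [linearLift, cls]

theorem cls_congr {A : Type*} {B : Type*} [Finite A] [Finite B] {P : Preorder A} {Q : Preorder B}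
    (h : Iso P Q) : cls K P = cls K Q := by
  rw [cls, cls, isoclass_eq_iff.2 h]

/-- `∑ [P_{A ∖ O}] ⊗ [P_O]`, the sum being over the open sets `O` of `P`. -/
noncomputable def openSum {A : Type v} [Finite A] (P : Preorder A) : Hqp K ⊗[K] Hqp K :=
  ∑ᶠ O : {O : Set A // IsOpen[top P] O}, cls K (restrict P (O.1)ᶜ) ⊗ₜ[K] cls K (restrict P O.1)

/-- `∑ [P / r] ⊗ [P | r]`, the sum being over the `P`-compatible equivalences `r`. -/
noncomputable def compatibleSum {A : Type v} [Finite A] (P : Preorder A) : Hqp K ⊗[K] Hqp K :=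
  ∑ᶠ r : {r : Setoid A // Compatible P r}, cls K (contract P r.1) ⊗ₜ[K] cls K (restrictRel P r.1)

theorem openSum_congr {A : Type*} {B : Type*} [Finite A] [Finite B] {P : Preorder A}
    {Q : Preorder B} (h : Iso P Q) : openSum K P = openSum K Q := by
  obtain ⟨e, he⟩ := h
  have hO : ∀ O : Set A, IsOpen[top P] O ↔ IsOpen[top Q] (e.symm ⁻¹' O) := by
    intro O
    constructor
    · intro h x y hxy hx
      refine h (a := e.symm x) (b := e.symm y) ?_ hx
      exact (he _ _).2 (by simpa using hxy)
    · intro h x y hxy hx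
      have := h (a := e x) (b := e y) ((he _ _).1 hxy) (by simpa using hx)
      simpa using this
  refine finsum_eq_of_bijective
    (fun O => ⟨e.symm ⁻¹' O.1, (hO O.1).1 O.2⟩ : _ → {O : Set B // IsOpen[top Q] O}) ⟨?_, ?_⟩ ?_
  · intro O O' h
    exact Subtype.ext (e.symm.surjective.preimage_injective (congrArg Subtype.val h))
  · rintro ⟨O, hO'⟩
    have : e.symm ⁻¹' (e ⁻¹' O) = O := by ext; simp
    exact ⟨⟨e ⁻¹' O, (hO _).2 (by rwa [this])⟩, Subtype.ext this⟩
  · intro O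
    rw [cls_congr K (Iso.restrict e he (O.1)ᶜ (e.symm ⁻¹' O.1)ᶜ (by simp)),
      cls_congr K (Iso.restrict e he O.1 (e.symm ⁻¹' O.1) (by simp))]

theorem compatibleSum_congr {A : Type*} {B : Type*} [Finite A] [Finite B] {P : Preorder A}
    {Q : Preorder B} (h : Iso P Q) : compatibleSum K P = compatibleSum K Q := by
  obtain ⟨e, he⟩ := h
  have hr : ∀ (r : Setoid A) x y, r x y ↔ (r.comap e.symm) (e x) (e y) := by
    intro r x y
    simp [Setoid.comap_rel]
  have he' : ∀ x y, Q.le x y ↔ P.le (e.symm x) (e.symm y) := fun x y => by simp [he]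
  refine finsum_eq_of_bijective
    (fun r => ⟨r.1.comap e.symm, r.2.map e he _ _ (hr r.1)⟩ :
      _ → {r : Setoid B // Compatible Q r}) ⟨?_, ?_⟩ ?_
  · intro r r' h
    have h1 : r.1.comap e.symm = r'.1.comap e.symm := congrArg Subtype.val h
    refine Subtype.ext (Setoid.ext fun x y => ?_)
    rw [hr r.1, hr r'.1, h1]
  · rintro ⟨s, hs⟩
    refine ⟨⟨s.comap e, hs.map e.symm he' _ _ fun x y => ?_⟩, Subtype.ext ?_⟩
    · simp [Setoid.comap_rel]
    · ext x y
      simp [Setoid.comap_rel]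
  · intro r
    rw [cls_congr K (P := contract P r.1) (Q := contract Q (r.1.comap e.symm))
        ⟨e, contract_le_map e he _ _ (hr r.1)⟩,
      cls_congr K (P := restrictRel P r.1) (Q := restrictRel Q (r.1.comap e.symm))
        ⟨e, fun x y => and_congr (he x y) (hr r.1 x y)⟩]

/-- The coproduct `Δ` of `H_qp`. -/
noncomputable def Delta : Hqp K →ₗ[K] Hqp K ⊗[K] Hqp K :=
  linearLift K (Qp.lift (fun _ P => openSum K P) fun _ _ _ _ h => openSum_congr K h)

/-- The coproduct `δ` of `H_qp`. -/
noncomputable def delta : Hqp K →ₗ[K] Hqp K ⊗[K] Hqp K :=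
  linearLift K (Qp.lift (fun _ P => compatibleSum K P) fun _ _ _ _ h => compatibleSum_congr K h)

open Classical in
/-- The counit `ε` of `Δ`: it sends the empty quasi-poset to `1` and the others to `0`. -/
noncomputable def eps : Hqp K →ₗ[K] K :=
  linearLift K fun q => if q = 1 then 1 else 0

open Classical in
/-- The counit `ε'` of `δ`: it sends discrete quasi-posets to `1` and the others to `0`. -/
noncomputable def eps' : Hqp K →ₗ[K] K :=
  linearLift K (Qp.lift (fun _ P => if IsDiscrete P then 1 else 0) fun _ _ _ _ h => by
    simp only [show IsDiscrete _ ↔ IsDiscrete _ from ⟨h.isDiscrete, h.symm.isDiscrete⟩])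

/-- `ehr` as a linear map from `H_qp` to `K[X]`. -/
noncomputable def ehrMap [CharZero K] : Hqp K →ₗ[K] K[X] :=
  linearLift K (Qp.lift (fun _ P => (ehr P).map (algebraMap ℚ K)) fun _ _ _ _ h => by
    simp only [ehr_congr h])

/-- `ehr^str` as a linear map from `H_qp` to `K[X]`. -/
noncomputable def ehrStrMap [CharZero K] : Hqp K →ₗ[K] K[X] :=
  linearLift K (Qp.lift (fun _ P => (ehrStr P).map (algebraMap ℚ K)) fun _ _ _ _ h => by
    simp only [ehrStr_congr h])

theorem Delta_cls {A : Type v} [Finite A] (P : Preorder A) : Delta K (cls K P) = openSum K P := by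
  obtain ⟨n, Q, h⟩ := exists_fin_iso P
  rw [cls_congr K h, openSum_congr K h, Delta, linearLift_cls, Qp.lift_fin]

theorem delta_cls {A : Type v} [Finite A] (P : Preorder A) :
    delta K (cls K P) = compatibleSum K P := by
  obtain ⟨n, Q, h⟩ := exists_fin_iso P
  rw [cls_congr K h, compatibleSum_congr K h, delta, linearLift_cls, Qp.lift_fin]

/-- The coproduct `Δ` of `K[X]`, an algebra morphism for which `X` is primitive. -/
noncomputable def polyDelta : K[X] →ₐ[K] K[X] ⊗[K] K[X] :=
  aeval (X ⊗ₜ[K] 1 + 1 ⊗ₜ[K] X)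

variable {K}

/-- An algebra morphism `H_qp → K[X]` is a Hopf algebra morphism from `(H_qp, m, Δ)` to
`(K[X], m, Δ)`: it is compatible with the coproducts and the counits (and hence the antipodes). -/
structure IsHopfMorphism (φ : Hqp K →ₐ[K] K[X]) : Prop where
  comul : ∀ x, TensorProduct.map φ.toLinearMap φ.toLinearMap (Delta K x) = polyDelta K (φ x)
  counit : ∀ x, (φ x).eval 0 = eps K x

/-- `φ` is homogeneous, `H_qp` being graded by `cl` and `K[X]` by the degree. -/
def IsHomogeneous (φ : Hqp K →ₐ[K] K[X]) : Prop :=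
  ∀ (n : ℕ) (P : Preorder (Fin n)), φ (cls K P) ∈ Submodule.span K {(X : K[X]) ^ cl P}

/-- The characterization of `φ₀`: homogeneous Hopf algebra morphism sending every quasi-poset
formed by `n ≥ 1` equivalent elements to `X`. -/
structure IsPhiZero (φ : Hqp K →ₐ[K] K[X]) : Prop where
  hopf : IsHopfMorphism φ
  homogeneous : IsHomogeneous φ
  block : ∀ n : ℕ, 1 ≤ n → φ (cls K (block n)) = X

variable (K) in
/-- The characters of `H_qp`, the elements of `M_qp`. -/
abbrev Mqp : Type u := Hqp K →ₐ[K] K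

/-- The product of `M_qp`: the convolution `(χ ⊗ χ') ∘ δ`. -/
noncomputable def conv (χ χ' : Mqp K) : Hqp K →ₗ[K] K :=
  (TensorProduct.rid K K).toLinearMap ∘ₗ
    TensorProduct.map χ.toLinearMap χ'.toLinearMap ∘ₗ delta K

/-- `χ'` is the inverse of `χ` in the monoid `M_qp`, the unit of which is `ε'`. -/
def IsInverse (χ χ' : Mqp K) : Prop := conv χ χ' = eps' K ∧ conv χ' χ = eps' K

/-- The action `φ ← χ = (φ ⊗ χ) ∘ δ` of characters. -/
noncomputable def act (φ : Hqp K →ₐ[K] K[X]) (χ : Mqp K) : Hqp K →ₗ[K] K[X] :=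
  (TensorProduct.rid K K[X]).toLinearMap ∘ₗ
    TensorProduct.map φ.toLinearMap χ.toLinearMap ∘ₗ delta K

end Hopf

end QuasiPoset

/-! The central notion is a family of polynomials compatible with `Δ`, expressed by values: `F(P)(x
+ y)` is the sum over open `O` of `F(P_{|A∖O})(x) F(P_{|O})(y)` (`IsComultiplicative`). Such
families are rigid in two ways. They are determined by their values at 0 and 1
(`IsComultiplicative.eq_of_eval_one`). And if two of them are 1 on the empty quasi-poset and agree
on all proper restrictions of a nonempty `P`, their difference at `P` is an additive polynomial,
hence a multiple of `X` (`additive_sub_of_restrict`, `eq_smul_X_of_additive`).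

Cutting a map to `{1, …, k + l}` at height `k` shows that `ehr` and `ehrStr` are of this kind;
cutting a heap-ordering shows it for `φ₀(P) = (μ_P / cl(P)!) X^cl(P)`. Duality follows from the
first principle once `ehr_P(-1)` is known: it is `(-1)^cl(P)` for discrete `P` and 0 otherwise, by a
sign-reversing involution on discrete open sets (`ehr_eval_neg_one`).

Characters act on comultiplicative families (`isComultiplicative_act`). In `φ₀ ← χ` at `P` the
coefficients below `X^cc(P)` vanish and that of `X^cc(P)` is `χ_P`, because the partition into
connected components is the coarsest compatible equivalence. So `χ` can be read off `φ₀ ← χ`, and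
the second principle shows that acting on `φ₀` by the lowest coefficients of `φ` gives back `φ`
(`act_phiZero_lowestCoeff`). This produces `α` and `α^str`, and duality at the coefficient of
`X^cc(P)` compares them.

For `β = (-1)^(cl + cc) λ`, the product `β * α` at `P` is `(-1)^cc(P) ehr_P(-1)`, already computed.
Up to sign, `α * β` at `P` is the coefficient of `X^cc(P)` in `ehr^str ← λ`, which equals `φ₀` by
the first principle. Uniqueness of the inverse comes from the triangularity of convolution
(`eq_of_conv_eq`), so coassociativity of `δ` is never needed. -/

namespace QuasiPoset

/-! ### Classes of a quasi-order and additivity of `cl`. -/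

section Classes

variable {A : Type u} {B : Type v}

theorem card_quotient_comap (e : A ≃ B) (s : Setoid B) :
    Nat.card (Quotient (s.comap e)) = Nat.card (Quotient s) :=
  Nat.card_congr (Quotient.congr e fun _ _ => Iff.rfl)

theorem card_quotient_sum [Finite A] [Finite B] (s : Setoid (A ⊕ B))
    (h : ∀ a b, ¬ s (Sum.inl a) (Sum.inr b)) :
    Nat.card (Quotient s) =
      Nat.card (Quotient (s.comap Sum.inl)) + Nat.card (Quotient (s.comap Sum.inr)) := by
  rw [← Nat.card_sum]
  refine (Nat.card_congr (Equiv.ofBijective (Sum.elim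
    (Quotient.map' Sum.inl fun _ _ h => h) (Quotient.map' Sum.inr fun _ _ h => h) :
      Quotient (s.comap Sum.inl) ⊕ Quotient (s.comap Sum.inr) → Quotient s) ⟨?_, ?_⟩)).symm
  · rintro (x | x) (y | y) <;> induction x using Quotient.inductionOn' <;>
      induction y using Quotient.inductionOn' <;> intro hxy
    · exact congrArg Sum.inl (Quotient.sound' (Quotient.exact (s := s) hxy))
    · exact (h _ _ (Quotient.exact hxy)).elim
    · exact (h _ _ (s.symm (Quotient.exact hxy))).elim
    · exact congrArg Sum.inr (Quotient.sound' (Quotient.exact (s := s) hxy))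
  · intro x
    induction x using Quotient.inductionOn' with | h x
    rcases x with x | x
    · exact ⟨Sum.inl (Quotient.mk'' x), rfl⟩
    · exact ⟨Sum.inr (Quotient.mk'' x), rfl⟩

/-- The equivalence `∼_P`. -/
abbrev sim (P : Preorder A) : Setoid A := AntisymmRel.setoid A P.le

theorem sim_iff {P : Preorder A} {x y : A} : sim P x y ↔ P.le x y ∧ P.le y x := Iff.rfl

theorem cl_eq (P : Preorder A) : cl P = Nat.card (Quotient (sim P)) := rfl

theorem cl_congr {P : Preorder A} {Q : Preorder B} (h : Iso P Q) : cl P = cl Q := by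
  obtain ⟨e, he⟩ := h
  exact Nat.card_congr (Quotient.congr e fun x y => and_congr (he x y) (he y x))

theorem disjointUnion_inl {P : Preorder A} {Q : Preorder B} {x y : A} :
    (disjointUnion P Q).le (Sum.inl x) (Sum.inl y) ↔ P.le x y := Sum.liftRel_inl_inl

theorem disjointUnion_inr {P : Preorder A} {Q : Preorder B} {x y : B} :
    (disjointUnion P Q).le (Sum.inr x) (Sum.inr y) ↔ Q.le x y := Sum.liftRel_inr_inr

theorem disjointUnion_inl_inr {P : Preorder A} {Q : Preorder B} {x : A} {y : B} :
    ¬ (disjointUnion P Q).le (Sum.inl x) (Sum.inr y) := Sum.not_liftRel_inl_inr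

theorem disjointUnion_inr_inl {P : Preorder A} {Q : Preorder B} {x : A} {y : B} :
    ¬ (disjointUnion P Q).le (Sum.inr y) (Sum.inl x) := Sum.not_liftRel_inr_inl

theorem cl_disjointUnion [Finite A] [Finite B] (P : Preorder A) (Q : Preorder B) :
    cl (disjointUnion P Q) = cl P + cl Q := by
  rw [cl_eq, card_quotient_sum _ fun a b h => disjointUnion_inl_inr (sim_iff.1 h).1]
  congr 2
  · congr 1
    ext x y
    exact and_congr disjointUnion_inl disjointUnion_inl
  · congr 1
    ext x y
    exact and_congr disjointUnion_inr disjointUnion_inr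

/-- An open set is a union of classes of `∼_P`, so no class is cut. This is what makes `X ^ cl` and
the sign `(-1) ^ cl` compatible with `Δ`. -/
theorem cl_add_cl_compl [Finite A] (P : Preorder A) (O : Set A)
    (hO : ∀ x y, P.le x y → x ∈ O → y ∈ O) :
    cl (restrict P Oᶜ) + cl (restrict P O) = cl P := by
  classical
  rw [add_comm, cl_eq P, ← card_quotient_comap (Equiv.Set.sumCompl O),
    card_quotient_sum _ fun a b h => b.2 (hO _ _ (sim_iff.1 h).1 a.2)]
  rfl

theorem cl_eq_zero_iff [Finite A] {P : Preorder A} : cl P = 0 ↔ IsEmpty A := by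
  rw [cl_eq, Finite.card_eq_zero_iff]
  exact ⟨fun h => ⟨fun a => h.elim (Quotient.mk'' a)⟩,
    fun h => ⟨fun q => Quotient.inductionOn' q fun a => h.elim a⟩⟩

theorem cl_pos [Finite A] [Nonempty A] (P : Preorder A) : 0 < cl P := by
  rw [Nat.pos_iff_ne_zero, Ne, cl_eq_zero_iff]
  simp

theorem cl_block {n : ℕ} (hn : 1 ≤ n) : cl (block n) = 1 := by
  rw [cl_eq, Nat.card_eq_one_iff_unique]
  refine ⟨⟨fun x y => ?_⟩, ⟨Quotient.mk'' ⟨0, hn⟩⟩⟩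
  induction x using Quotient.inductionOn'
  induction y using Quotient.inductionOn'
  exact Quotient.sound' ⟨trivial, trivial⟩

theorem iso_block_of_cl_eq_one {P : Preorder A} [Finite A] (h : cl P = 1) :
    ∃ n, 1 ≤ n ∧ Iso P (block n) := by
  obtain ⟨h1, ⟨q⟩⟩ := Nat.card_eq_one_iff_unique.1 h
  induction q using Quotient.inductionOn' with | h a
  have : Nonempty A := ⟨a⟩
  refine ⟨Nat.card A, Nat.card_pos, Finite.equivFin A, fun x y => iff_of_true ?_ trivial⟩
  have h2 : (Quotient.mk'' x : Quotient (sim P)) = Quotient.mk'' y := h1.elim _ _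
  exact (Quotient.exact h2).1

theorem iso_of_isEmpty [IsEmpty A] [IsEmpty B] (P : Preorder A) (Q : Preorder B) : Iso P Q :=
  ⟨Equiv.equivOfIsEmpty A B, fun x => isEmptyElim x⟩

end Classes

/-! ### Connected components as classes of the equivalence generated by the order. -/

section Components

variable {A : Type u} {B : Type v}

/-- The equivalence generated by `≤_P`, whose classes are the connected components of `P`. -/
abbrev comp (P : Preorder A) : Setoid A := Relation.EqvGen.setoid P.le

theorem comp_le {P : Preorder A} {r : Setoid A} (h : ∀ x y, P.le x y → r x y) : comp P ≤ r := by
  intro x y hxy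
  induction hxy with
  | rel x y h' => exact h x y h'
  | refl x => exact r.refl x
  | symm x y _ ih => exact r.symm ih
  | trans x y z _ _ ih ih' => exact r.trans ih ih'

theorem comp_of_le {P : Preorder A} {x y : A} (h : P.le x y) : comp P x y :=
  Relation.EqvGen.rel x y h

/-- A class of the generated equivalence is clopen, hence contains the component of each of its
points. Conversely `a ≤ b` puts `a` in the closure of `{b}`, which is preconnected. -/
theorem connectedComponent_eq_iff (P : Preorder A) (x y : A) :
    @connectedComponent A (top P) x = @connectedComponent A (top P) y ↔ comp P x y := by
  let := top P
  constructor
  · intro h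
    have hclopen : IsClopen {z | comp P x z} := by
      constructor
      · rw [← isOpen_compl_iff]
        intro a b hab ha hb
        exact ha ((comp P).trans hb ((comp P).symm (comp_of_le hab)))
      · intro a b hab ha
        exact (comp P).trans ha (comp_of_le hab)
    refine hclopen.connectedComponent_subset ((comp P).refl x) ?_
    rw [h]
    exact mem_connectedComponent
  · refine fun h => comp_le (r := Setoid.ker connectedComponent) (fun a b hab => ?_) h
    have hs : a ∈ closure {b} := by
      rw [mem_closure_iff]
      intro O hO ha
      exact ⟨b, hO hab ha, rfl⟩
    exact (connectedComponent_eq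
      (isPreconnected_singleton.closure.subset_connectedComponent
        (subset_closure (Set.mem_singleton b)) hs)).symm

theorem cc_eq (P : Preorder A) : cc P = Nat.card (Quotient (comp P)) := by
  let := top P
  exact Nat.card_congr (Quotient.congr (Equiv.refl A) fun x y => connectedComponent_eq_iff P x y)

theorem connectedSpace_iff (P : Preorder A) :
    @ConnectedSpace A (top P) ↔ Nonempty A ∧ ∀ x y, comp P x y := by
  let := top P
  constructor
  · intro h
    refine ⟨h.toNonempty, fun x y => (connectedComponent_eq_iff P x y).1 ?_⟩
    have := h.toPreconnectedSpace
    rw [PreconnectedSpace.connectedComponent_eq_univ, PreconnectedSpace.connectedComponent_eq_univ]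
  · rintro ⟨⟨x⟩, h⟩
    refine connectedSpace_iff_connectedComponent.2 ⟨x, ?_⟩
    refine Set.eq_univ_of_forall fun y => ?_
    rw [(connectedComponent_eq_iff P x y).2 (h x y)]
    exact mem_connectedComponent

/-- The connectedness relation restricts to subsets which are unions of connected components. -/
theorem comp_restrict {P : Preorder A} {S : Set A} (hS : ∀ x y, P.le x y → (x ∈ S ↔ y ∈ S))
    {x y : A} (h : comp P x y) :
    (x ∈ S ↔ y ∈ S) ∧ ∀ (hx : x ∈ S) (hy : y ∈ S), comp (restrict P S) ⟨x, hx⟩ ⟨y, hy⟩ := by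
  induction h with
  | rel x y h => exact ⟨hS x y h, fun _ _ => comp_of_le h⟩
  | refl x => exact ⟨Iff.rfl, fun _ _ => Setoid.refl' _ _⟩
  | symm x y _ ih => exact ⟨ih.1.symm, fun hx hy => (comp _).symm (ih.2 hy hx)⟩
  | trans x y z _ _ ih ih' =>
    exact ⟨ih.1.trans ih'.1, fun hx hz =>
      (comp _).trans (ih.2 hx (ih.1.1 hx)) (ih'.2 (ih.1.1 hx) hz)⟩

theorem comp_map {P : Preorder A} {Q : Preorder B} (f : A → B)
    (hf : ∀ x y, P.le x y → Q.le (f x) (f y)) {x y : A} (h : comp P x y) :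
    comp Q (f x) (f y) :=
  comp_le (r := (comp Q).comap f) (fun a b hab => comp_of_le (hf a b hab)) h

theorem cc_congr {P : Preorder A} {Q : Preorder B} (h : Iso P Q) : cc P = cc Q := by
  obtain ⟨e, he⟩ := h
  rw [cc_eq, cc_eq]
  refine Nat.card_congr (Quotient.congr e fun x y => ⟨comp_map e fun a b => (he a b).1, fun h => ?_⟩)
  have := comp_map (P := Q) (Q := P) e.symm (fun a b hab => (he _ _).2 (by simpa using hab)) h
  simpa using this

theorem cc_disjointUnion [Finite A] [Finite B] (P : Preorder A) (Q : Preorder B) :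
    cc (disjointUnion P Q) = cc P + cc Q := by
  have key : ∀ x y, comp (disjointUnion P Q) x y →
      Sum.LiftRel (comp P) (comp Q) x y := by
    intro x y h
    induction h with
    | rel x y h =>
      exact Sum.LiftRel.mono (fun _ _ => comp_of_le) (fun _ _ => comp_of_le) h
    | refl x => exact Sum.LiftRel.refl _ _ x
    | symm x y _ ih =>
      cases ih with
      | inl h => exact Sum.LiftRel.inl ((comp P).symm h)
      | inr h => exact Sum.LiftRel.inr ((comp Q).symm h)
    | trans x y z _ _ ih ih' =>
      cases ih with
      | inl h => cases ih' with | inl h' => exact Sum.LiftRel.inl ((comp P).trans h h')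
      | inr h => cases ih' with | inr h' => exact Sum.LiftRel.inr ((comp Q).trans h h')
  rw [cc_eq, cc_eq, cc_eq, card_quotient_sum _ fun a b h => Sum.not_liftRel_inl_inr (key _ _ h)]
  congr 2
  · congr 1
    ext x y
    exact ⟨fun h => Sum.liftRel_inl_inl.1 (key _ _ h),
      comp_map Sum.inl fun _ _ => disjointUnion_inl.2⟩
  · congr 1
    ext x y
    exact ⟨fun h => Sum.liftRel_inr_inr.1 (key _ _ h),
      comp_map Sum.inr fun _ _ => disjointUnion_inr.2⟩

theorem cc_eq_zero_iff [Finite A] {P : Preorder A} : cc P = 0 ↔ IsEmpty A := by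
  rw [cc_eq, Finite.card_eq_zero_iff]
  exact ⟨fun h => ⟨fun a => h.elim (Quotient.mk'' a)⟩,
    fun h => ⟨fun q => Quotient.inductionOn' q fun a => h.elim a⟩⟩

/-- A quasi-poset is the disjoint union of the parts of a partition into two open sets. -/
theorem iso_disjointUnion_restrict (P : Preorder A) (S : Set A)
    (hS : ∀ x y, P.le x y → (x ∈ S ↔ y ∈ S)) :
    Iso (disjointUnion (restrict P S) (restrict P Sᶜ)) P := by
  classical
  refine ⟨Equiv.Set.sumCompl S, ?_⟩
  rintro (x | x) (y | y)
  · exact disjointUnion_inl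
  · exact iff_of_false disjointUnion_inl_inr fun h => y.2 ((hS _ _ h).1 x.2)
  · exact iff_of_false disjointUnion_inr_inl fun h => x.2 ((hS _ _ h).2 y.2)
  · exact disjointUnion_inr

theorem IsDiscrete.cc_eq_cl {P : Preorder A} (h : IsDiscrete P) : cc P = cl P := by
  rw [cc_eq, cl_eq]
  congr 2
  refine le_antisymm (comp_le fun x y hxy => ⟨hxy, h x y hxy⟩) fun x y hxy => comp_of_le hxy.1

end Components

/-! ### Compatible equivalences and the statistics of `P / r` and `P | r`. -/

section Compatible

variable {A : Type u} {B : Type v}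

/-- Each class of `r` is saturated for `P | r`, so connectedness of the classes can be tested inside
`P | r`, without subtypes. -/
theorem compatible_iff {P : Preorder A} {r : Setoid A} :
    Compatible P r ↔ r ≤ comp (restrictRel P r) ∧
      ∀ x y, (contract P r).le x y → (contract P r).le y x → r x y := by
  constructor
  · intro h
    refine ⟨fun x y hxy => ?_, h.eq_of_contract⟩
    exact comp_map (P := restrict P {z | r x z}) (Q := restrictRel P r) Subtype.val
      (fun a b hab => ⟨hab, r.trans (r.symm a.2) b.2⟩)
      (((connectedSpace_iff _).1 (h.connected x)).2 ⟨x, r.refl x⟩ ⟨y, hxy⟩)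
  · rintro ⟨h, h'⟩
    refine ⟨fun x => (connectedSpace_iff _).2 ⟨⟨x, r.refl x⟩, fun a b => ?_⟩, h'⟩
    have := (comp_restrict (P := restrictRel P r) (S := {z | r x z}) (fun a b hab =>
      ⟨fun ha => r.trans ha hab.2, fun hb => r.trans hb (r.symm hab.2)⟩)
      (h (r.trans (r.symm a.2) b.2))).2 a.2 b.2
    exact comp_map (P := restrict (restrictRel P r) {z | r x z}) id (fun _ _ h => h.1) this

theorem le_contract (P : Preorder A) (r : Setoid A) {x y : A} (h : P.le x y) :
    (contract P r).le x y := Relation.TransGen.single (Or.inl h)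

theorem rel_contract (P : Preorder A) (r : Setoid A) {x y : A} (h : r x y) :
    (contract P r).le x y := Relation.TransGen.single (Or.inr h)

theorem contract_le_setoid {P : Preorder A} {r s : Setoid A} (hP : ∀ x y, P.le x y → s x y)
    (hr : r ≤ s) {x y : A} (h : (contract P r).le x y) : s x y := by
  induction h with
  | single h => exact h.elim (hP _ _) fun h => hr h
  | tail _ h ih => exact s.trans ih (h.elim (hP _ _) fun h => hr h)

/-- This begins the bookkeeping for `δ`: `r` is at once the class relation of `P / r` and the
component relation of `P | r`, while `P / r` keeps the components of `P` and `P | r` keeps its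
classes. The sign computations for the inverse depend on these four facts. -/
theorem Compatible.sim_contract {P : Preorder A} {r : Setoid A} (h : Compatible P r) :
    sim (contract P r) = r := by
  ext x y
  exact ⟨fun hxy => h.eq_of_contract x y hxy.1 hxy.2,
    fun hxy => ⟨rel_contract P r hxy, rel_contract P r (r.symm hxy)⟩⟩

theorem Compatible.cl_contract {P : Preorder A} {r : Setoid A} (h : Compatible P r) :
    cl (contract P r) = Nat.card (Quotient r) := by
  rw [cl_eq, h.sim_contract]

theorem Compatible.le_comp {P : Preorder A} {r : Setoid A} (h : Compatible P r) : r ≤ comp P :=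
  (compatible_iff.1 h).1.trans (comp_le fun _ _ hxy => comp_of_le hxy.1)

theorem Compatible.comp_restrictRel {P : Preorder A} {r : Setoid A} (h : Compatible P r) :
    comp (restrictRel P r) = r :=
  le_antisymm (comp_le fun _ _ hxy => hxy.2) (compatible_iff.1 h).1

theorem Compatible.comp_contract {P : Preorder A} {r : Setoid A} (h : Compatible P r) :
    comp (contract P r) = comp P :=
  le_antisymm (comp_le fun _ _ => contract_le_setoid (fun _ _ => comp_of_le) h.le_comp)
    (comp_le fun _ _ hxy => comp_of_le (le_contract P r hxy))

theorem Compatible.cc_contract {P : Preorder A} {r : Setoid A} (h : Compatible P r) :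
    cc (contract P r) = cc P := by
  rw [cc_eq, cc_eq, h.comp_contract]

theorem Compatible.cc_restrictRel {P : Preorder A} {r : Setoid A} (h : Compatible P r) :
    cc (restrictRel P r) = Nat.card (Quotient r) := by
  rw [cc_eq, h.comp_restrictRel]

theorem Compatible.cl_restrictRel {P : Preorder A} {r : Setoid A} (h : Compatible P r) :
    cl (restrictRel P r) = cl P := by
  rw [cl_eq, cl_eq]
  congr 2
  ext x y
  refine ⟨fun hxy => ⟨hxy.1.1, hxy.2.1⟩, fun hxy => ?_⟩
  have hr := h.eq_of_contract x y (le_contract P r hxy.1) (le_contract P r hxy.2)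
  exact ⟨⟨hxy.1, hr⟩, ⟨hxy.2, r.symm hr⟩⟩

/-- The partition into components is the coarsest compatible equivalence. Its term in `δ(P)` is a
discrete quasi-poset tensor `P`, the leading term of every triangular argument below. -/
theorem compatible_comp (P : Preorder A) : Compatible P (comp P) := by
  refine compatible_iff.2 ⟨comp_le fun x y h => comp_of_le ⟨h, comp_of_le h⟩, fun x y h _ => ?_⟩
  exact contract_le_setoid (fun _ _ => comp_of_le) le_rfl h

theorem restrictRel_eq_self {P : Preorder A} {r : Setoid A} (h : ∀ x y, P.le x y → r x y) :
    restrictRel P r = P :=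
  Preorder.ext fun x y => ⟨fun hxy => hxy.1, fun hxy => ⟨hxy, h x y hxy⟩⟩

theorem restrictRel_comp (P : Preorder A) : restrictRel P (comp P) = P :=
  restrictRel_eq_self fun _ _ => comp_of_le

theorem isDiscrete_contract_comp (P : Preorder A) : IsDiscrete (contract P (comp P)) :=
  fun _ _ h => rel_contract P _
    ((comp P).symm (contract_le_setoid (fun _ _ => comp_of_le) le_rfl h))

/-- In a discrete contraction `x ≤ y` makes `x` and `y` equivalent there, and compatibility turns
this into `r x y`. -/
theorem Compatible.eq_comp_of_isDiscrete {P : Preorder A} {r : Setoid A} (h : Compatible P r)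
    (hd : IsDiscrete (contract P r)) : r = comp P :=
  le_antisymm h.le_comp (comp_le fun x y hxy =>
    h.eq_of_contract x y (le_contract P r hxy) (hd _ _ (le_contract P r hxy)))

theorem card_quotient_lt [Finite A] {r s : Setoid A} (h : r < s) :
    Nat.card (Quotient s) < Nat.card (Quotient r) := by
  have hf : Function.Surjective (Quotient.map' (s₁ := r) (s₂ := s) id fun _ _ hxy => h.le hxy) := by
    intro q
    induction q using Quotient.inductionOn' with | h x
    exact ⟨Quotient.mk'' x, rfl⟩
  refine lt_of_le_of_ne (Nat.card_le_card_of_surjective _ hf) fun hc => h.not_ge ?_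
  have hinj := ((Nat.bijective_iff_surjective_and_card _).2 ⟨hf, hc.symm⟩).1
  intro x y hxy
  exact Quotient.exact (hinj (a₁ := Quotient.mk'' x) (a₂ := Quotient.mk'' y) (Quotient.sound' hxy))

theorem Compatible.cc_lt [Finite A] {P : Preorder A} {r : Setoid A} (h : Compatible P r)
    (hr : r ≠ comp P) : cc P < Nat.card (Quotient r) := by
  rw [cc_eq]
  exact card_quotient_lt (lt_of_le_of_ne h.le_comp hr)

end Compatible

/-! ### The coproducts as finite sums. -/

section FiniteSums

variable {A : Type u} {B : Type v}

instance [Finite A] : Finite (Setoid A) :=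
  Finite.of_injective (fun r : Setoid A => r.r) fun _ _ h => Setoid.ext fun x y => by
    exact iff_of_eq (congrFun (congrFun h x) y)

/-- The open sets of a finite quasi-poset. -/
noncomputable def opens [Finite A] (P : Preorder A) : Finset (Set A) :=
  (Set.toFinite {O | ∀ x y, P.le x y → x ∈ O → y ∈ O}).toFinset

theorem mem_opens [Finite A] {P : Preorder A} {O : Set A} :
    O ∈ opens P ↔ ∀ x y, P.le x y → x ∈ O → y ∈ O := by
  simp [opens]

/-- The compatible equivalences of a finite quasi-poset. -/
noncomputable def compatibles [Finite A] (P : Preorder A) : Finset (Setoid A) :=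
  (Set.toFinite {r | Compatible P r}).toFinset

theorem mem_compatibles [Finite A] {P : Preorder A} {r : Setoid A} :
    r ∈ compatibles P ↔ Compatible P r := by
  simp [compatibles]

variable (K : Type*) [Field K]

theorem openSum_eq [Finite A] (P : Preorder A) :
    openSum K P = ∑ O ∈ opens P, cls K (restrict P Oᶜ) ⊗ₜ[K] cls K (restrict P O) := by
  rw [opens, ← finsum_mem_eq_finite_toFinset_sum, ← finsum_set_coe_eq_finsum_mem]
  refine finsum_eq_of_bijective (Equiv.subtypeEquivRight fun O => ?_) (Equiv.bijective _)
    fun _ => rfl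
  exact ⟨fun h x y hxy hx => h hxy hx, fun h x y hxy hx => h x y hxy hx⟩

theorem compatibleSum_eq [Finite A] (P : Preorder A) :
    compatibleSum K P =
      ∑ r ∈ compatibles P, cls K (contract P r) ⊗ₜ[K] cls K (restrictRel P r) := by
  rw [compatibles, ← finsum_mem_eq_finite_toFinset_sum, ← finsum_set_coe_eq_finsum_mem]
  rfl

end FiniteSums

/-! ### Maps out of `H_qp`, and compatibility with `Δ` by evaluation. -/

section Linear

variable (K : Type u) [Field K]

variable {K} in
theorem linearMap_ext {M : Type*} [AddCommGroup M] [Module K M] {f g : Hqp K →ₗ[K] M}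
    (h : ∀ (n : ℕ) (P : Preorder (Fin n)), f (cls K P) = g (cls K P)) : f = g := by
  refine LinearMap.ext fun x => ?_
  induction x using MonoidAlgebra.induction_linear with
  | zero => rw [map_zero, map_zero]
  | add x y hx hy => rw [map_add, map_add, hx, hy]
  | single q c =>
    induction q using Qp.ind with | h n P
    have : MonoidAlgebra.single (isoclass P) c = c • cls K P := by
      simp [cls]
    rw [this, map_smul, map_smul, h]

variable {K} in
theorem algHom_ext_cls {R : Type*} [Ring R] [Algebra K R] {f g : Hqp K →ₐ[K] R}
    (h : ∀ (n : ℕ) (P : Preorder (Fin n)), f (cls K P) = g (cls K P)) : f = g :=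
  AlgHom.toLinearMap_injective (linearMap_ext h)

theorem cls_disjointUnion {A B : Type*} [Finite A] [Finite B] (P : Preorder A) (Q : Preorder B) :
    cls K (disjointUnion P Q) = cls K P * cls K Q := by
  rw [cls, cls, cls, ← isoclass_mul, map_mul]

theorem cls_of_isEmpty {A : Type*} [IsEmpty A] (P : Preorder A) : cls K P = 1 := by
  rw [cls_congr K (iso_of_isEmpty P (block 0)), cls, ← one_eq_isoclass, map_one]

/-- The algebra morphism on `H_qp` given by a multiplicative function on isoclasses. -/
noncomputable def homOfMul {R : Type*} [CommRing R] [Algebra K R] (F : Qp → R) (h1 : F 1 = 1)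
    (hF : ∀ a b, F (a * b) = F a * F b) : Hqp K →ₐ[K] R :=
  MonoidAlgebra.lift K R Qp ⟨⟨F, h1⟩, hF⟩

theorem homOfMul_cls {R : Type*} [CommRing R] [Algebra K R] (F : Qp → R) (h1 : F 1 = 1)
    (hF : ∀ a b, F (a * b) = F a * F b) {A : Type*} [Finite A] (P : Preorder A) :
    homOfMul K F h1 hF (cls K P) = F (isoclass P) := by
  simp [homOfMul, cls]

/-- Induction on quasi-posets: the empty one, the connected ones, and the disjoint unions. -/
theorem induction_connected {motive : ∀ (A : Type v) [Finite A], Preorder A → Prop}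
    (hiso : ∀ (A B : Type v) [Finite A] [Finite B] (P : Preorder A) (Q : Preorder B),
      Iso P Q → motive A P → motive B Q)
    (hempty : ∀ (A : Type v) [Finite A] (P : Preorder A), IsEmpty A → motive A P)
    (hconn : ∀ (A : Type v) [Finite A] (P : Preorder A), cc P = 1 → motive A P)
    (hunion : ∀ (A B : Type v) [Finite A] [Finite B] (P : Preorder A) (Q : Preorder B),
      motive A P → motive B Q → motive (A ⊕ B) (disjointUnion P Q))
    (A : Type v) [Finite A] (P : Preorder A) : motive A P := by
  induction hn : Nat.card A using Nat.strong_induction_on generalizing A with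
  | _ n ih =>
    subst hn
    rcases isEmpty_or_nonempty A with h | ⟨⟨a⟩⟩
    · exact hempty A P h
    by_cases hc : ∀ x, comp P a x
    · refine hconn A P ?_
      rw [cc_eq, Nat.card_eq_one_iff_unique]
      refine ⟨⟨fun x y => ?_⟩, ⟨Quotient.mk'' a⟩⟩
      induction x using Quotient.inductionOn'
      induction y using Quotient.inductionOn'
      exact Quotient.sound' ((comp P).trans ((comp P).symm (hc _)) (hc _))
    · push Not at hc
      obtain ⟨b, hb⟩ := hc
      -- The component of `a` is split off; since `a` lies in `S` and `b` does not, both parts are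
      -- strictly smaller.
      set S : Set A := {x | comp P a x} with hS
      have hstable : ∀ x y, P.le x y → (x ∈ S ↔ y ∈ S) := fun x y h =>
        ⟨fun hx => (comp P).trans hx (comp_of_le h),
          fun hy => (comp P).trans hy ((comp P).symm (comp_of_le h))⟩
      refine hiso _ _ _ _ (iso_disjointUnion_restrict P S hstable) (hunion _ _ _ _ ?_ ?_)
      · exact ih _ (Finite.card_subtype_lt (x := b) hb) S _ rfl
      · exact ih _ (Finite.card_subtype_lt (x := a) (fun h => h ((comp P).refl a))) (Sᶜ : Set A) _ rfl

variable {K}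

theorem conv_cls (χ χ' : Mqp K) {A : Type v} [Finite A] (P : Preorder A) :
    conv χ χ' (cls K P) =
      ∑ r ∈ compatibles P, χ (cls K (contract P r)) * χ' (cls K (restrictRel P r)) := by
  simp [conv, delta_cls, compatibleSum_eq, mul_comm]

theorem act_cls (φ : Hqp K →ₐ[K] K[X]) (χ : Mqp K) {A : Type v} [Finite A] (P : Preorder A) :
    act φ χ (cls K P) =
      ∑ r ∈ compatibles P, C (χ (cls K (restrictRel P r))) * φ (cls K (contract P r)) := by
  simp [act, delta_cls, compatibleSum_eq, smul_eq_C_mul]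

/-- The evaluation of the two variables of `K[X] ⊗ K[X]`. -/
noncomputable def evalTensor (x y : K) : K[X] ⊗[K] K[X] →ₐ[K] K :=
  Algebra.TensorProduct.lift (aeval x) (aeval y) fun _ _ => Commute.all _ _

theorem evalTensor_tmul (x y : K) (p q : K[X]) :
    evalTensor x y (p ⊗ₜ q) = p.eval x * q.eval y := by
  simp [evalTensor, coe_aeval_eq_eval]

theorem evalTensor_polyDelta (x y : K) (p : K[X]) :
    evalTensor x y (polyDelta K p) = p.eval (x + y) := by
  have : (evalTensor x y).comp (polyDelta K) = aeval (x + y) := by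
    ext
    simp [polyDelta, evalTensor_tmul]
  rw [← AlgHom.comp_apply, this, coe_aeval_eq_eval]

/-- `K[X] ⊗ K[X]` is the ring of polynomials in two variables, and over an infinite field these are
determined by their values. -/
theorem evalTensor_injective [Infinite K] {s t : K[X] ⊗[K] K[X]}
    (h : ∀ x y : K, evalTensor x y s = evalTensor x y t) : s = t := by
  have key : ∀ (x y : K) (p : K[X][X]),
      evalTensor x y (polyEquivTensor K K[X] p) = (p.eval (C y)).eval x := by
    intro x y p
    induction p using Polynomial.induction_on' with
    | add p q hp hq => rw [map_add, map_add, hp, hq, eval_add, eval_add]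
    | monomial n a =>
      simp [polyEquivTensor_apply, eval₂_monomial, evalTensor_tmul, ← map_pow]
  obtain ⟨p, rfl⟩ := (polyEquivTensor K K[X]).surjective s
  obtain ⟨q, rfl⟩ := (polyEquivTensor K K[X]).surjective t
  congr 1
  simp only [key] at h
  have hinf : Set.Infinite (Set.range (C : K → K[X])) := Set.infinite_range_of_injective C_injective
  refine eq_of_infinite_eval_eq p q (hinf.mono ?_)
  rintro _ ⟨y, rfl⟩
  exact Polynomial.funext fun x => h x y

/-- Compatibility with the coproduct `Δ`, in terms of evaluations. -/
def IsComultiplicative (F : ∀ (A : Type v) [Finite A], Preorder A → K[X]) : Prop :=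
  ∀ (A : Type v) [Finite A] (P : Preorder A) (x y : K), (F A P).eval (x + y) =
    ∑ O ∈ opens P, (F _ (restrict P Oᶜ)).eval x * (F _ (restrict P O)).eval y

theorem isComultiplicative_of_comul {f : Hqp K →ₗ[K] K[X]}
    (hf : ∀ h, TensorProduct.map f f (Delta K h) = polyDelta K (f h)) :
    IsComultiplicative fun (_ : Type v) _ P => f (cls K P) := by
  intro A _ P x y
  have := congrArg (evalTensor x y) (hf (cls K P))
  rw [evalTensor_polyDelta] at this
  rw [← this, Delta_cls, openSum_eq]
  simp [evalTensor_tmul]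

theorem comul_of_isComultiplicative [Infinite K] {f : Hqp K →ₗ[K] K[X]}
    (hf : IsComultiplicative fun (_ : Type) _ P => f (cls K P)) (h : Hqp K) :
    TensorProduct.map f f (Delta K h) = polyDelta K (f h) := by
  refine LinearMap.congr_fun (f := TensorProduct.map f f ∘ₗ Delta K)
    (g := (polyDelta K).toLinearMap ∘ₗ f) (linearMap_ext fun n P => evalTensor_injective
      fun x y => ?_) h
  have := hf _ P x y
  simp only [LinearMap.comp_apply, AlgHom.toLinearMap_apply]
  rw [evalTensor_polyDelta, this, Delta_cls, openSum_eq]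
  simp [evalTensor_tmul]

/-- Both sides are polynomial in each variable, so the identity extends from natural numbers one
variable at a time: first in `x` for fixed `l`, then in `y` for fixed `x`. -/
theorem isComultiplicative_of_nat [CharZero K]
    {F : ∀ (A : Type v) [Finite A], Preorder A → K[X]}
    (hF : ∀ (A : Type v) [Finite A] (P : Preorder A) (k l : ℕ), (F A P).eval (k + l : K) =
      ∑ O ∈ opens P, (F _ (restrict P Oᶜ)).eval (k : K) * (F _ (restrict P O)).eval (l : K)) :
    IsComultiplicative F := by
  have hinf : Set.Infinite (Set.range (Nat.cast : ℕ → K)) :=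
    Set.infinite_range_of_injective Nat.cast_injective
  intro A _ P x y
  have h1 : ∀ l : ℕ, (F A P).comp (X + C (l : K)) =
      ∑ O ∈ opens P, F _ (restrict P Oᶜ) * C ((F _ (restrict P O)).eval (l : K)) := by
    intro l
    refine eq_of_infinite_eval_eq _ _ (hinf.mono ?_)
    rintro _ ⟨k, rfl⟩
    simpa [eval_finsetSum] using hF A P k l
  have h2 : (F A P).comp (C x + X) =
      ∑ O ∈ opens P, C ((F _ (restrict P Oᶜ)).eval x) * F _ (restrict P O) := by
    refine eq_of_infinite_eval_eq _ _ (hinf.mono ?_)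
    rintro _ ⟨l, rfl⟩
    simpa [eval_finsetSum] using congrArg (eval x) (h1 l)
  simpa [eval_finsetSum] using congrArg (eval y) h2

end Linear

/-! ### Rigidity of comultiplicative families and additive polynomials. -/

section Principle

variable {K : Type u} [Field K]

/-- A comultiplicative family is determined by its values at `1`, and by its values at `0`. -/
theorem IsComultiplicative.eq_of_eval_one [CharZero K]
    {F G : ∀ (A : Type v) [Finite A], Preorder A → K[X]}
    (hF : IsComultiplicative F) (hG : IsComultiplicative G)
    (h0 : ∀ (A : Type v) [Finite A] (P : Preorder A), (F A P).eval 0 = (G A P).eval 0)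
    (h1 : ∀ (A : Type v) [Finite A] (P : Preorder A), (F A P).eval 1 = (G A P).eval 1)
    (A : Type v) [Finite A] (P : Preorder A) : F A P = G A P := by
  have key : ∀ (k : ℕ) (A : Type v) [Finite A] (P : Preorder A),
      (F A P).eval (k : K) = (G A P).eval (k : K) := by
    intro k
    induction k with
    | zero => intro A _ P; simpa using h0 A P
    | succ k ih =>
      intro A _ P
      -- The value at `k + 1` is a combination of values at `k` and at 1 of restrictions, which is
      -- why the induction runs over all quasi-posets simultaneously.
      rw [Nat.cast_succ, hF, hG]
      exact Finset.sum_congr rfl fun O _ => by rw [ih, h1]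
  refine eq_of_infinite_eval_eq _ _
    ((Set.infinite_range_of_injective (Nat.cast_injective (R := K))).mono ?_)
  rintro _ ⟨k, rfl⟩
  exact key k A P

/-- A polynomial which is an additive function is a multiple of `X`. -/
theorem eq_smul_X_of_additive [CharZero K] {p : K[X]}
    (h : ∀ x y, p.eval (x + y) = p.eval x + p.eval y) : p = C (p.eval 1) * X := by
  refine eq_of_infinite_eval_eq _ _
    ((Set.infinite_range_of_injective (Nat.cast_injective (R := K))).mono ?_)
  rintro _ ⟨k, rfl⟩
  have h0 : p.eval 0 = 0 := by simpa using h 0 0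
  induction k with
  | zero => simp [h0]
  | succ k ih =>
    simp only [Set.mem_ofPred_eq, eval_mul, eval_C, eval_X] at ih ⊢
    rw [Nat.cast_succ, h, ih]
    ring

end Principle

/-! ### Cutting maps to `Fin (k + l)` along an open set. -/

section Glue

variable {A : Type u} {k l : ℕ}

theorem castAdd_lt_natAdd (a : Fin k) (b : Fin l) : Fin.castAdd l a < Fin.natAdd k b := by
  rw [Fin.lt_def, Fin.val_castAdd, Fin.val_natAdd]
  exact lt_of_lt_of_le a.2 (Nat.le_add_right _ _)

open Classical in
/-- The map `A → Fin (k + l)` given by a map to the first `k` elements on the complement of `O`, and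
a map to the last `l` elements on `O`. -/
noncomputable def glue (O : Set A) (f : (Oᶜ : Set A) → Fin k) (g : O → Fin l) (a : A) :
    Fin (k + l) :=
  if h : a ∈ O then Fin.natAdd k (g ⟨a, h⟩) else Fin.castAdd l (f ⟨a, h⟩)

theorem glue_of_mem {O : Set A} (f : (Oᶜ : Set A) → Fin k) (g : O → Fin l) {a : A} (h : a ∈ O) :
    glue O f g a = Fin.natAdd k (g ⟨a, h⟩) := dif_pos h

theorem glue_of_notMem {O : Set A} (f : (Oᶜ : Set A) → Fin k) (g : O → Fin l) {a : A}
    (h : a ∉ O) : glue O f g a = Fin.castAdd l (f ⟨a, h⟩) := dif_neg h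

/-- The set `O` is recovered from the glued map as the preimage of the top `l` values, whence the
injectivity of gluing. -/
theorem le_glue_iff {O : Set A} {f : (Oᶜ : Set A) → Fin k} {g : O → Fin l} {a : A} :
    k ≤ (glue O f g a : ℕ) ↔ a ∈ O := by
  by_cases h : a ∈ O
  · simp [glue_of_mem f g h, h]
  · simp [glue_of_notMem f g h, h]

/-- Counting maps to `Fin (k + l)` by means of the preimage of the last `l` elements. -/
theorem ncard_eq_sum_opens [Finite A] (P : Preorder A) (S : Set (A → Fin (k + l)))
    (S₁ : ∀ O : Set A, Set ((Oᶜ : Set A) → Fin k)) (S₂ : ∀ O : Set A, Set (O → Fin l))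
    (hS : ∀ h ∈ S, {a | k ≤ (h a : ℕ)} ∈ opens P)
    (hglue : ∀ O ∈ opens P, ∀ f g, glue O f g ∈ S ↔ f ∈ S₁ O ∧ g ∈ S₂ O) :
    S.ncard = ∑ O ∈ opens P, (S₁ O).ncard * (S₂ O).ncard := by
  have hbij : Function.Bijective (fun x : Σ O : opens P, S₁ O.1 × S₂ O.1 =>
      (⟨glue x.1.1 x.2.1.1 x.2.2.1, (hglue _ x.1.2 _ _).2 ⟨x.2.1.2, x.2.2.2⟩⟩ : S)) := by
    constructor
    · rintro ⟨⟨O, hO⟩, ⟨f, hf⟩, ⟨g, hg⟩⟩ ⟨⟨O', hO'⟩, ⟨f', hf'⟩, ⟨g', hg'⟩⟩ h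
      have h1 : glue O f g = glue O' f' g' := congrArg Subtype.val h
      obtain rfl : O = O' := by
        ext a
        rw [← le_glue_iff (f := f) (g := g), h1, le_glue_iff]
      obtain rfl : f = f' := by
        ext a
        have := congrFun h1 a
        rw [glue_of_notMem _ _ a.2, glue_of_notMem _ _ a.2] at this
        simpa using congrArg Fin.val this
      obtain rfl : g = g' := by
        ext a
        have := congrFun h1 a
        rw [glue_of_mem _ _ a.2, glue_of_mem _ _ a.2] at this
        simpa using congrArg Fin.val this
      rfl
    · rintro ⟨h, hh⟩
      have hO := hS h hh
      set O : Set A := {a | k ≤ (h a : ℕ)} with hOdef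
      have hlt : ∀ a : (Oᶜ : Set A), (h a : ℕ) < k := fun a => not_le.1 a.2
      have hle : ∀ a : O, k ≤ (h a : ℕ) := fun a => a.2
      have hg : glue O (fun a => ⟨h a, hlt a⟩)
          (fun a => ⟨h a - k, by have := (h a).2; have := hle a; omega⟩) = h := by
        ext a
        by_cases ha : a ∈ O
        · rw [glue_of_mem _ _ ha]
          simpa using Nat.add_sub_of_le ha
        · rw [glue_of_notMem _ _ ha]
          simp
      obtain ⟨h1, h2⟩ := (hglue O hO _ _).1 (by rw [hg]; exact hh)
      exact ⟨⟨⟨O, hO⟩, ⟨_, h1⟩, ⟨_, h2⟩⟩, Subtype.ext hg⟩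
  rw [← Nat.card_coe_set_eq, ← Nat.card_congr (Equiv.ofBijective _ hbij), Nat.card_sigma,
    ← Finset.sum_coe_sort (opens P)]
  exact Finset.sum_congr rfl fun O _ => by
    rw [Nat.card_prod, Nat.card_coe_set_eq, Nat.card_coe_set_eq]

variable {P : Preorder A} {O : Set A} {f : (Oᶜ : Set A) → Fin k} {g : O → Fin l}

theorem mem_opens_of_mem_L [Finite A] {h : A → Fin (k + l)} (hh : h ∈ L P (k + l)) :
    {a | k ≤ (h a : ℕ)} ∈ opens P :=
  mem_opens.2 fun x y hxy hx => le_trans hx (Fin.le_def.1 (hh x y hxy) : (h x : ℕ) ≤ h y)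

/-- Only relations between the two sides need care: from the complement to `O` values increase
automatically, and from `O` to the complement there is no relation, `O` being open. -/
theorem glue_mem_L [Finite A] (hO : O ∈ opens P) :
    glue O f g ∈ L P (k + l) ↔ f ∈ L (restrict P Oᶜ) k ∧ g ∈ L (restrict P O) l := by
  constructor
  · intro h
    constructor
    · intro i j hij
      have := h i j hij
      rwa [glue_of_notMem _ _ i.2, glue_of_notMem _ _ j.2] at this
    · intro i j hij
      have := h i j hij
      rwa [glue_of_mem _ _ i.2, glue_of_mem _ _ j.2, Fin.natAdd_le_natAdd_iff] at this
  · rintro ⟨h1, h2⟩ i j hij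
    by_cases hj : j ∈ O
    · by_cases hi : i ∈ O
      · rw [glue_of_mem _ _ hi, glue_of_mem _ _ hj, Fin.natAdd_le_natAdd_iff]
        exact h2 _ _ hij
      · rw [glue_of_notMem _ _ hi, glue_of_mem _ _ hj]
        exact (castAdd_lt_natAdd _ _).le
    · have hi : i ∉ O := fun hi => hj (mem_opens.1 hO i j hij hi)
      rw [glue_of_notMem _ _ hi, glue_of_notMem _ _ hj]
      exact h1 _ _ hij

theorem glue_eq_glue_iff {i j : A} : glue O f g i = glue O f g j ↔
    (∃ (hi : i ∈ O) (hj : j ∈ O), g ⟨i, hi⟩ = g ⟨j, hj⟩) ∨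
      ∃ (hi : i ∉ O) (hj : j ∉ O), f ⟨i, hi⟩ = f ⟨j, hj⟩ := by
  by_cases hi : i ∈ O <;> by_cases hj : j ∈ O
  · simp [hi, hj, glue_of_mem]
  · simp [hi, hj, glue_of_mem, glue_of_notMem, (castAdd_lt_natAdd _ _).ne']
  · simp [hi, hj, glue_of_mem, glue_of_notMem, (castAdd_lt_natAdd _ _).ne]
  · simp [hi, hj, glue_of_notMem]

theorem glue_mem_LStr [Finite A] (hO : O ∈ opens P) :
    glue O f g ∈ LStr P (k + l) ↔ f ∈ LStr (restrict P Oᶜ) k ∧ g ∈ LStr (restrict P O) l := by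
  simp only [LStr, Set.mem_ofPred_eq, glue_mem_L hO, glue_eq_glue_iff]
  constructor
  · rintro ⟨⟨h1, h2⟩, h⟩
    exact ⟨⟨h1, fun i j hij hf => h i j hij (Or.inr ⟨i.2, j.2, hf⟩)⟩,
      ⟨h2, fun i j hij hg => h i j hij (Or.inl ⟨i.2, j.2, hg⟩)⟩⟩
  · rintro ⟨⟨h1, h1'⟩, h2, h2'⟩
    refine ⟨⟨h1, h2⟩, ?_⟩
    rintro i j hij (⟨hi, hj, h⟩ | ⟨hi, hj, h⟩)
    · exact h2' ⟨i, hi⟩ ⟨j, hj⟩ hij h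
    · exact h1' ⟨i, hi⟩ ⟨j, hj⟩ hij h

/-- The order-preserving maps which are injective on the poset of classes. -/
def linearMaps (P : Preorder A) (k : ℕ) : Set (A → Fin k) :=
  {f | f ∈ L P k ∧ ∀ i j, f i = f j → P.le i j}

theorem glue_mem_linearMaps [Finite A] (hO : O ∈ opens P) :
    glue O f g ∈ linearMaps P (k + l) ↔
      f ∈ linearMaps (restrict P Oᶜ) k ∧ g ∈ linearMaps (restrict P O) l := by
  simp only [linearMaps, Set.mem_ofPred_eq, glue_mem_L hO, glue_eq_glue_iff]
  constructor
  · rintro ⟨⟨h1, h2⟩, h⟩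
    exact ⟨⟨h1, fun i j hf => h i j (Or.inr ⟨i.2, j.2, hf⟩)⟩,
      ⟨h2, fun i j hg => h i j (Or.inl ⟨i.2, j.2, hg⟩)⟩⟩
  · rintro ⟨⟨h1, h1'⟩, h2, h2'⟩
    refine ⟨⟨h1, h2⟩, ?_⟩
    rintro i j (⟨hi, hj, h⟩ | ⟨hi, hj, h⟩)
    · exact h2' ⟨i, hi⟩ ⟨j, hj⟩ h
    · exact h1' ⟨i, hi⟩ ⟨j, hj⟩ h

variable (P) (k l)

theorem ncard_L_add [Finite A] : (L P (k + l)).ncard =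
    ∑ O ∈ opens P, (L (restrict P Oᶜ) k).ncard * (L (restrict P O) l).ncard :=
  ncard_eq_sum_opens P _ _ _ (fun _ => mem_opens_of_mem_L) fun _ hO _ _ => glue_mem_L hO

theorem ncard_LStr_add [Finite A] : (LStr P (k + l)).ncard =
    ∑ O ∈ opens P, (LStr (restrict P Oᶜ) k).ncard * (LStr (restrict P O) l).ncard :=
  ncard_eq_sum_opens P _ _ _ (fun _ h => mem_opens_of_mem_L h.1) fun _ hO _ _ => glue_mem_LStr hO

theorem ncard_linearMaps_add [Finite A] : (linearMaps P (k + l)).ncard =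
    ∑ O ∈ opens P, (linearMaps (restrict P Oᶜ) k).ncard * (linearMaps (restrict P O) l).ncard :=
  ncard_eq_sum_opens P _ _ _ (fun _ h => mem_opens_of_mem_L h.1)
    fun _ hO _ _ => glue_mem_linearMaps hO

end Glue

/-! ### Multiplicativity and special values of the Ehrhart polynomials. -/

section Ehrhart

variable {A : Type u} {B : Type v} [Finite A] [Finite B]

theorem ehr_disjointUnion (P : Preorder A) (Q : Preorder B) :
    ehr (disjointUnion P Q) = ehr P * ehr Q := by
  refine poly_eq_of_nat fun k => ?_
  rw [eval_mul, ehr_eval, ehr_eval, ehr_eval, ← Nat.cast_mul, ← Nat.card_coe_set_eq,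
    ← Nat.card_coe_set_eq, ← Nat.card_coe_set_eq, ← Nat.card_prod]
  congr 1
  refine Nat.card_congr (((Equiv.sumArrowEquivProdArrow A B (Fin k)).subtypeEquiv
    (q := fun x => x.1 ∈ L P k ∧ x.2 ∈ L Q k) fun f => ?_).trans (Equiv.Set.prod _ _))
  simp [L, Equiv.sumArrowEquivProdArrow]

theorem ehrStr_disjointUnion (P : Preorder A) (Q : Preorder B) :
    ehrStr (disjointUnion P Q) = ehrStr P * ehrStr Q := by
  refine poly_eq_of_nat fun k => ?_
  rw [eval_mul, ehrStr_eval, ehrStr_eval, ehrStr_eval, ← Nat.cast_mul, ← Nat.card_coe_set_eq,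
    ← Nat.card_coe_set_eq, ← Nat.card_coe_set_eq, ← Nat.card_prod]
  congr 1
  refine Nat.card_congr (((Equiv.sumArrowEquivProdArrow A B (Fin k)).subtypeEquiv
    (q := fun x => x.1 ∈ LStr P k ∧ x.2 ∈ LStr Q k) fun f => ?_).trans (Equiv.Set.prod _ _))
  simp [LStr, L, Equiv.sumArrowEquivProdArrow]
  tauto

theorem ehr_eval_zero (P : Preorder A) [Nonempty A] : (ehr P).eval 0 = 0 := by
  have := ehr_eval P 0
  rw [Set.eq_empty_of_isEmpty (L P 0)] at this
  simpa using this

theorem ehrStr_eval_zero (P : Preorder A) [Nonempty A] : (ehrStr P).eval 0 = 0 := by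
  have := ehrStr_eval P 0
  rw [Set.eq_empty_of_isEmpty (LStr P 0)] at this
  simpa using this

theorem ehr_eval_one (P : Preorder A) : (ehr P).eval 1 = 1 := by
  have := ehr_eval P 1
  have h1 : L P 1 = Set.univ := Set.eq_univ_of_forall fun f i j _ => (Subsingleton.elim _ _).le
  rw [h1, Set.ncard_univ, Nat.card_unique] at this
  simpa using this

open Classical in
theorem ehrStr_eval_one (P : Preorder A) :
    (ehrStr P).eval 1 = if IsDiscrete P then 1 else 0 := by
  have := ehrStr_eval P 1
  split_ifs with hP
  · have h1 : LStr P 1 = Set.univ := Set.eq_univ_of_forall fun f =>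
      ⟨fun i j _ => (Subsingleton.elim _ _).le, fun i j h _ => hP i j h⟩
    rw [h1, Set.ncard_univ, Nat.card_unique] at this
    simpa using this
  · have h1 : LStr P 1 = ∅ := Set.eq_empty_of_forall_notMem fun f hf =>
      hP fun i j h => hf.2 i j h (Subsingleton.elim _ _)
    rw [h1, Set.ncard_empty] at this
    simpa using this

theorem ehr_of_isEmpty (P : Preorder A) [IsEmpty A] : ehr P = 1 := by
  refine poly_eq_of_nat fun k => ?_
  have h1 : L P k = Set.univ := Set.eq_univ_of_forall fun f i => isEmptyElim i
  rw [ehr_eval, h1, Set.ncard_univ, Nat.card_unique]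
  simp

theorem ehrStr_of_isEmpty (P : Preorder A) [IsEmpty A] : ehrStr P = 1 := by
  refine poly_eq_of_nat fun k => ?_
  have h1 : LStr P k = Set.univ := Set.eq_univ_of_forall fun f =>
    ⟨fun i => isEmptyElim i, fun i => isEmptyElim i⟩
  rw [ehrStr_eval, h1, Set.ncard_univ, Nat.card_unique]
  simp

end Ehrhart

theorem isComultiplicative_ehr :
    IsComultiplicative (K := ℚ) fun (A : Type v) [Finite A] (P : Preorder A) => ehr P := by
  refine isComultiplicative_of_nat fun A _ P k l => ?_
  rw [← Nat.cast_add, ehr_eval, ncard_L_add]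
  simp only [ehr_eval]
  push_cast
  rfl

theorem isComultiplicative_ehrStr :
    IsComultiplicative (K := ℚ) fun (A : Type v) [Finite A] (P : Preorder A) => ehrStr P := by
  refine isComultiplicative_of_nat fun A _ P k l => ?_
  rw [← Nat.cast_add, ehrStr_eval, ncard_LStr_add]
  simp only [ehrStr_eval]
  push_cast
  rfl

/-! ### The value of `ehr` at `-1` and the duality principle. -/

section Duality

variable {A : Type u}

theorem cl_restrict_union [Finite A] (P : Preorder A) {S T : Set A} (hST : Disjoint S T)
    (hS : ∀ x y, sim P x y → x ∈ S → y ∈ S) :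
    cl (restrict P (S ∪ T)) = cl (restrict P S) + cl (restrict P T) := by
  classical
  rw [cl_eq, ← card_quotient_comap (Equiv.Set.union hST).symm, card_quotient_sum]
  · rfl
  · intro a b h
    exact Set.disjoint_left.1 hST (hS a b h a.2) b.2

theorem cl_restrict_sim [Finite A] (P : Preorder A) (m : A) :
    cl (restrict P {y | sim P m y}) = 1 := by
  rw [cl_eq, Nat.card_eq_one_iff_unique]
  refine ⟨⟨fun x y => ?_⟩, ⟨Quotient.mk'' ⟨m, (sim P).refl m⟩⟩⟩
  induction x using Quotient.inductionOn' with | h x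
  induction y using Quotient.inductionOn' with | h y
  exact Quotient.sound' ((sim P).trans ((sim P).symm x.2) y.2 : sim P x y)

theorem exists_maximal_element [Finite A] [Nonempty A] (P : Preorder A) :
    ∃ m, ∀ y, P.le m y → P.le y m := by
  let := P
  obtain ⟨m, -, hm⟩ := Set.finite_univ.exists_maximal (s := (Set.univ : Set A)) Set.univ_nonempty
  exact ⟨m, fun y h => hm trivial h⟩

open Classical in
-- The class `M` of a maximal element is open, and adding it to or removing it from an open discrete
-- set leaves an open discrete set. This toggling changes `cl` by one, so the terms cancel in pairs.
-- Removal uses discreteness: an element of `O` below `M` already lies in `M`.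
theorem sum_discrete_opens [Finite A] [Nonempty A] (P : Preorder A) :
    ∑ O ∈ opens P, (if IsDiscrete (restrict P O) then (-1) ^ cl (restrict P O) else 0 : ℚ) = 0 := by
  obtain ⟨m, hm⟩ := exists_maximal_element P
  set M : Set A := {y | sim P m y} with hM
  have hMsat : ∀ x y, P.le x y → x ∈ M → y ∈ M := fun x y hxy hx => by
    have := P.le_trans _ _ _ hx.1 hxy
    exact ⟨this, hm y this⟩
  rw [← Finset.sum_filter]
  have hmem : ∀ O, O ∈ (opens P).filter (fun O => IsDiscrete (restrict P O)) ↔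
      (∀ x y, P.le x y → x ∈ O → y ∈ O) ∧ ∀ x ∈ O, ∀ y ∈ O, P.le x y → P.le y x := by
    intro O
    rw [Finset.mem_filter, mem_opens]
    exact and_congr_right fun _ => ⟨fun h x hx y hy => h ⟨x, hx⟩ ⟨y, hy⟩,
      fun h x y => h x x.2 y y.2⟩
  have hsub : ∀ O ∈ (opens P).filter (fun O => IsDiscrete (restrict P O)), m ∈ O → M ⊆ O :=
    fun O hO hmO y hy => ((hmem O).1 hO).1 m y hy.1 hmO
  have hunion : ∀ O ∈ (opens P).filter (fun O => IsDiscrete (restrict P O)),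
      O ∪ M ∈ (opens P).filter (fun O => IsDiscrete (restrict P O)) := by
    intro O hO
    rw [hmem] at hO ⊢
    refine ⟨fun x y hxy hx => hx.imp (hO.1 x y hxy) (hMsat x y hxy), ?_⟩
    rintro x (hx | hx) y hy hxy
    · exact hO.2 x hx y (hO.1 x y hxy hx) hxy
    · exact P.le_trans _ _ _ (hMsat x y hxy hx).2 hx.1
  have hdiff : ∀ O ∈ (opens P).filter (fun O => IsDiscrete (restrict P O)),
      O \ M ∈ (opens P).filter (fun O => IsDiscrete (restrict P O)) := by
    intro O hO
    rw [hmem] at hO ⊢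
    refine ⟨fun x y hxy hx => ⟨hO.1 x y hxy hx.1, fun hy => hx.2 ?_⟩,
      fun x hx y hy => hO.2 x hx.1 y hy.1⟩
    exact hMsat y x (hO.2 x hx.1 y (hO.1 x y hxy hx.1) hxy) hy
  have hdisj : ∀ O ∈ (opens P).filter (fun O => IsDiscrete (restrict P O)), m ∉ O →
      Disjoint O M := fun O hO hmO => Set.disjoint_left.2 fun x hx hx' =>
    hmO (((hmem O).1 hO).1 x m hx'.2 hx)
  have hcl : ∀ O, Disjoint O M → cl (restrict P (O ∪ M)) = cl (restrict P O) + 1 := by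
    intro O h
    rw [Set.union_comm, cl_restrict_union P h.symm fun x y hxy hx => hMsat x y hxy.1 hx,
      cl_restrict_sim, add_comm]
  refine Finset.sum_involution (fun O _ => if m ∈ O then O \ M else O ∪ M) ?_ ?_ ?_ ?_
  · intro O hO
    by_cases hmO : m ∈ O
    · rw [if_pos hmO]
      have := hcl (O \ M) Set.disjoint_sdiff_left
      rw [Set.sdiff_union_of_subset (hsub O hO hmO)] at this
      rw [this]
      ring
    · rw [if_neg hmO, hcl O (hdisj O hO hmO)]
      ring
  · intro O hO _ h
    split_ifs at h with hmO
    · have : m ∈ O \ M := by rwa [h]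
      exact this.2 ((sim P).refl m)
    · have : m ∈ O := by
        rw [← h]
        exact Or.inr ((sim P).refl m)
      exact hmO this
  · intro O hO
    split_ifs with hmO
    · exact hdiff O hO
    · exact hunion O hO
  · intro O hO
    by_cases hmO : m ∈ O
    · have h1 : m ∉ O \ M := fun h => h.2 ((sim P).refl m)
      simp only [if_pos hmO, if_neg h1]
      exact Set.sdiff_union_of_subset (hsub O hO hmO)
    · have h1 : m ∈ O ∪ M := Or.inr ((sim P).refl m)
      simp only [if_neg hmO, if_pos h1]
      rw [Set.union_sdiff_right, (hdisj O hO hmO).sdiff_eq_left]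

theorem iso_restrict_univ (P : Preorder A) : Iso (restrict P Set.univ) P :=
  ⟨Equiv.Set.univ A, fun _ _ => Iff.rfl⟩

theorem univ_mem_opens [Finite A] (P : Preorder A) : Set.univ ∈ opens P :=
  mem_opens.2 fun _ _ _ _ => trivial

theorem empty_mem_opens [Finite A] (P : Preorder A) : ∅ ∈ opens P :=
  mem_opens.2 fun _ _ _ h => h

theorem card_restrict_lt [Finite A] {S : Set A} (hS : S ≠ Set.univ) :
    Nat.card S < Nat.card A := by
  obtain ⟨x, hx⟩ := (Set.ne_univ_iff_exists_notMem S).1 hS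
  exact Finite.card_subtype_lt (x := x) hx

open Classical in
-- Expanding `ehr_P(1 + (-1)) = 0` with `ehr(1) = 1` shows that the values at `-1` sum to zero over
-- the open subsets of a nonempty `P`. The right-hand side satisfies the same relation by
-- `sum_discrete_opens`, and the term `O = A` is determined by the others.
theorem ehr_eval_neg_one [Finite A] (P : Preorder A) :
    (ehr P).eval (-1) = if IsDiscrete P then (-1) ^ cl P else 0 := by
  induction hn : Nat.card A using Nat.strong_induction_on generalizing A with
  | _ n ih =>
    subst hn
    rcases isEmpty_or_nonempty A with h | h
    · rw [ehr_of_isEmpty, if_pos (show IsDiscrete P from fun x => isEmptyElim x),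
        cl_eq_zero_iff.2 h, pow_zero, eval_one]
    have h1 := isComultiplicative_ehr A P 1 (-1)
    have h2 := sum_discrete_opens P
    rw [add_neg_cancel, ehr_eval_zero] at h1
    rw [← Finset.add_sum_erase _ _ (univ_mem_opens P)] at h1 h2
    simp only [ehr_eval_one, one_mul] at h1
    rw [Finset.sum_congr rfl fun O hO => ih _ (card_restrict_lt (Finset.ne_of_mem_erase hO))
      (restrict P O) rfl, ehr_congr (iso_restrict_univ P)] at h1
    simp only [cl_congr (iso_restrict_univ P), show IsDiscrete (restrict P Set.univ) ↔ IsDiscrete P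
      from ⟨(iso_restrict_univ P).isDiscrete, (iso_restrict_univ P).symm.isDiscrete⟩] at h2
    linarith

/-- The duality principle. -/
theorem ehrStr_eq_ehr_comp_neg [Finite A] (P : Preorder A) :
    ehrStr P = (-1) ^ cl P * (ehr P).comp (-X) := by
  refine isComultiplicative_ehrStr.eq_of_eval_one
    (G := fun A _ P => (-1) ^ cl P * (ehr P).comp (-X)) ?_ ?_ ?_ A P
  · intro A _ P x y
    simp only [eval_mul, eval_comp, eval_neg, eval_X, eval_pow, eval_one]
    rw [neg_add, isComultiplicative_ehr A P, Finset.mul_sum]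
    refine Finset.sum_congr rfl fun O hO => ?_
    -- The sign is distributed over the two factors by additivity of `cl` across an open set.
    rw [← cl_add_cl_compl P O (mem_opens.1 hO)]
    ring
  · intro A _ P
    rcases isEmpty_or_nonempty A with h | h
    · simp [ehr_of_isEmpty, ehrStr_of_isEmpty, cl_eq_zero_iff.2 h]
    · simp [ehr_eval_zero, ehrStr_eval_zero]
  · intro A _ P
    simp only [eval_mul, eval_comp, eval_neg, eval_X, eval_pow, eval_one]
    -- At 1 the claim is `ehr^str_P(1) = (-1)^cl(P) ehr_P(-1)`, and both sides are the indicator of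
    -- discreteness.
    rw [ehr_eval_neg_one, ehrStr_eval_one]
    split_ifs
    · rw [← mul_pow]
      norm_num
    · simp

end Duality

/-! ### Counting heap-orderings. -/

section HeapOrderings

variable {A : Type u} {B : Type v}

theorem sim_eq_ker {P : Preorder A} {k : ℕ} {f : A → Fin k} (hf : f ∈ linearMaps P k) :
    sim P = Setoid.ker f := by
  ext x y
  exact ⟨fun h => le_antisymm (hf.1 x y h.1) (hf.1 y x h.2),
    fun h => ⟨hf.2 x y h, hf.2 y x (Eq.symm h)⟩⟩

theorem ncard_range_of_mem_linearMaps {P : Preorder A} {k : ℕ} {f : A → Fin k}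
    (hf : f ∈ linearMaps P k) : (Set.range f).ncard = cl P := by
  rw [cl_eq, sim_eq_ker hf, ← Nat.card_coe_set_eq]
  exact (Nat.card_congr (Setoid.quotientKerEquivRange f)).symm

theorem linearMaps_eq_empty {P : Preorder A} {k : ℕ} (hk : k < cl P) : linearMaps P k = ∅ := by
  refine Set.eq_empty_of_forall_notMem fun f hf => hk.not_ge ?_
  rw [← ncard_range_of_mem_linearMaps hf]
  simpa using Set.ncard_le_card (Set.range f)

theorem surjective_of_mem_linearMaps {P : Preorder A} {f : A → Fin (cl P)}
    (hf : f ∈ linearMaps P (cl P)) : Function.Surjective f := by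
  rw [← Set.range_eq_univ]
  refine Set.eq_of_subset_of_ncard_le (Set.subset_univ _) ?_
  rw [ncard_range_of_mem_linearMaps hf, Set.ncard_univ, Nat.card_fin]

/-- With exactly `cl P` values available, injectivity on classes means bijectivity. Describing
heap-orderings by maps on `A` avoids quotients and makes the gluing above applicable. -/
theorem ncard_linearMaps (P : Preorder A) : (linearMaps P (cl P)).ncard = heapOrderings P := by
  let := P
  rw [← Nat.card_coe_set_eq]
  refine (Nat.card_congr (Equiv.ofBijective
    (fun f : {f : Antisymmetrization A (· ≤ ·) ≃ Fin (cl P) // ∀ x y, x ≤ y → f x ≤ f y} =>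
      (⟨fun a => f.1 (toAntisymmetrization (· ≤ ·) a), fun i j hij => f.2 _ _ hij,
        fun i j hij => (Quotient.exact (f.1.injective hij)).1⟩ : linearMaps P (cl P)))
      ⟨?_, ?_⟩)).symm
  · intro f g h
    refine Subtype.ext (Equiv.ext fun q => ?_)
    induction q using Quotient.inductionOn' with | h a
    exact congrFun (congrArg Subtype.val h) a
  · rintro ⟨h, hh⟩
    let φ : Antisymmetrization A (· ≤ ·) → Fin (cl P) :=
      Quotient.lift h fun a b hab => le_antisymm (hh.1 a b hab.1) (hh.1 b a hab.2)
    have hφ : Function.Bijective φ := by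
      constructor
      · intro x y hxy
        induction x using Quotient.inductionOn' with | h x
        induction y using Quotient.inductionOn' with | h y
        exact Quotient.sound' ⟨hh.2 x y hxy, hh.2 y x (Eq.symm hxy)⟩
      · intro i
        obtain ⟨a, ha⟩ := surjective_of_mem_linearMaps hh i
        exact ⟨Quotient.mk'' a, ha⟩
    refine ⟨⟨Equiv.ofBijective φ hφ, fun x y => ?_⟩, rfl⟩
    induction x using Quotient.inductionOn' with | h x
    induction y using Quotient.inductionOn' with | h y
    exact hh.1 x y

theorem heapOrderings_congr {P : Preorder A} {Q : Preorder B} (h : Iso P Q) :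
    heapOrderings P = heapOrderings Q := by
  rw [← ncard_linearMaps, ← ncard_linearMaps, cl_congr h]
  obtain ⟨e, he⟩ := h
  rw [← Nat.card_coe_set_eq, ← Nat.card_coe_set_eq]
  refine Nat.card_congr ((e.arrowCongr (Equiv.refl _)).subtypeEquiv fun f => ?_)
  simp only [linearMaps, L, Set.mem_ofPred_eq, he, Equiv.arrowCongr_apply, Function.comp,
    Equiv.refl_apply, e.forall_congr_left, Equiv.apply_symm_apply]

/-- The poset of classes is an antichain, so every bijection preserves its order. -/
theorem heapOrderings_of_isDiscrete [Finite A] {P : Preorder A} (h : IsDiscrete P) :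
    heapOrderings P = (cl P).factorial := by
  classical
  let := P
  have : Finite (Antisymmetrization A P.le) := inferInstanceAs (Finite (Quotient (sim P)))
  have := Fintype.ofFinite (Antisymmetrization A P.le)
  have hc : Fintype.card (Antisymmetrization A P.le) = Fintype.card (Fin (cl P)) := by
    rw [Fintype.card_fin, ← Nat.card_eq_fintype_card]
    rfl
  rw [← Fintype.card_fin (cl P), ← hc, ← Fintype.card_equiv (Fintype.equivOfCardEq hc),
    ← Nat.card_eq_fintype_card]
  refine Nat.card_congr (Equiv.subtypeUnivEquiv fun f x y => ?_)
  induction x using Quotient.inductionOn' with | h x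
  induction y using Quotient.inductionOn' with | h y
  intro hxy
  rw [show (Quotient.mk'' x : Antisymmetrization A (· ≤ ·)) = Quotient.mk'' y from
    Quotient.sound' ⟨hxy, h x y hxy⟩]

open Classical in
-- A heap-ordering is cut at height `p.1`: the classes above the cut form an open set with `p.2`
-- classes, and both parts are heap-ordered independently.
theorem heapOrderings_eq_sum [Finite A] (P : Preorder A) {p : ℕ × ℕ}
    (hp : p ∈ Finset.HasAntidiagonal.antidiagonal (cl P)) :
    heapOrderings P = ∑ O ∈ (opens P).filter
      (fun O => (cl (restrict P Oᶜ), cl (restrict P O)) = p),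
        heapOrderings (restrict P Oᶜ) * heapOrderings (restrict P O) := by
  rw [Finset.HasAntidiagonal.mem_antidiagonal] at hp
  rw [← ncard_linearMaps, ← hp, ncard_linearMaps_add, Finset.sum_filter]
  refine Finset.sum_congr rfl fun O hO => ?_
  have h1 := cl_add_cl_compl P O (mem_opens.1 hO)
  split_ifs with h
  · rw [← ncard_linearMaps, ← ncard_linearMaps, ← h]
  -- The two sizes have the same total as `p`, so if they differ from `p` one part has more classes
  -- than available values.
  · have h2 : p.1 < cl (restrict P Oᶜ) ∨ p.2 < cl (restrict P O) := by
      by_contra! h'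
      exact h (Prod.ext (by simp; omega) (by simp; omega))
    rcases h2 with h2 | h2
    · rw [linearMaps_eq_empty h2, Set.ncard_empty, zero_mul]
    · rw [linearMaps_eq_empty h2, Set.ncard_empty, mul_zero]

theorem comp_mem_linearMaps {P : Preorder A} {i k : ℕ} (g : Fin i ↪o Fin k) (w : A → Fin i) :
    g ∘ w ∈ linearMaps P k ↔ w ∈ linearMaps P i := by
  simp [linearMaps, L]

theorem exists_orderEmbOfFin_comp {k n : ℕ} (T : Finset (Fin k)) (hT : T.card = n)
    (w : A → Fin k) (hw : ∀ a, w a ∈ T) : ∃ w', T.orderEmbOfFin hT ∘ w' = w :=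
  ⟨fun a => (T.orderIsoOfFin hT).symm ⟨w a, hw a⟩, funext fun a => by simp [Finset.orderEmbOfFin]⟩

theorem mem_linearMaps_disjointUnion {P : Preorder A} {Q : Preorder B} {k : ℕ}
    {h : A ⊕ B → Fin k} : h ∈ linearMaps (disjointUnion P Q) k ↔
      h ∘ Sum.inl ∈ linearMaps P k ∧ h ∘ Sum.inr ∈ linearMaps Q k ∧
        ∀ a b, h (Sum.inl a) ≠ h (Sum.inr b) := by
  simp [linearMaps, L]
  grind

/-- A heap-ordering of a disjoint union is a shuffle: the set `S` of heights occupied by `P` is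
arbitrary of size `cl P`, and each part is then ordered within its own heights. -/
theorem heapOrderings_disjointUnion [Finite A] [Finite B] (P : Preorder A) (Q : Preorder B) :
    heapOrderings (disjointUnion P Q) =
      (cl P + cl Q).choose (cl P) * (heapOrderings P * heapOrderings Q) := by
  classical
  have hcompl : ∀ S : {S : Finset (Fin (cl P + cl Q)) // S.card = cl P}, S.1ᶜ.card = cl Q := by
    intro S
    rw [Finset.card_compl, S.2, Fintype.card_fin, Nat.add_sub_cancel_left]
  have hne : ∀ (S : {S : Finset (Fin (cl P + cl Q)) // S.card = cl P}) i j,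
      S.1.orderEmbOfFin S.2 i ≠ S.1ᶜ.orderEmbOfFin (hcompl S) j := fun S i j h =>
    Finset.mem_compl.1 (Finset.orderEmbOfFin_mem S.1ᶜ (hcompl S) j)
      (h ▸ Finset.orderEmbOfFin_mem S.1 S.2 i)
  have hbij : Function.Bijective
      (fun x : {S : Finset (Fin (cl P + cl Q)) // S.card = cl P} ×
          (linearMaps P (cl P) × linearMaps Q (cl Q)) =>
        (⟨Sum.elim (x.1.1.orderEmbOfFin x.1.2 ∘ x.2.1.1)
          (x.1.1ᶜ.orderEmbOfFin (hcompl x.1) ∘ x.2.2.1), mem_linearMaps_disjointUnion.2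
            ⟨(comp_mem_linearMaps _ _).2 x.2.1.2, (comp_mem_linearMaps _ _).2 x.2.2.2,
              fun a b => hne x.1 (x.2.1.1 a) (x.2.2.1 b)⟩⟩ :
          linearMaps (disjointUnion P Q) (cl P + cl Q))) := by
    constructor
    · rintro ⟨⟨S, hS⟩, ⟨f, hf⟩, ⟨g, hg⟩⟩ ⟨⟨S', hS'⟩, ⟨f', hf'⟩, ⟨g', hg'⟩⟩ h
      have h1 := congrArg Subtype.val h
      have hl : S.orderEmbOfFin hS ∘ f = S'.orderEmbOfFin hS' ∘ f' :=
        funext fun a => congrFun h1 (Sum.inl a)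
      -- Since `f` and `f'` are surjective, `S` and `S'` are both the set of values taken on `P`.
      obtain rfl : S = S' := by
        have := congrArg Set.range hl
        rw [(surjective_of_mem_linearMaps hf).range_comp,
          (surjective_of_mem_linearMaps hf').range_comp, Finset.range_orderEmbOfFin,
          Finset.range_orderEmbOfFin] at this
        exact Finset.coe_injective this
      obtain rfl : f = f' := (S.orderEmbOfFin hS).injective.comp_left hl
      obtain rfl : g = g' := (Sᶜ.orderEmbOfFin _).injective.comp_left
        (funext fun b => congrFun h1 (Sum.inr b))
      rfl
    · rintro ⟨h, hh⟩
      obtain ⟨hP, hQ, hPQ⟩ := mem_linearMaps_disjointUnion.1 hh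
      set S : Finset (Fin (cl P + cl Q)) := (Set.range (h ∘ Sum.inl)).toFinset with hSdef
      have hS : S.card = cl P :=
        (Set.ncard_eq_toFinset_card' _).symm.trans (ncard_range_of_mem_linearMaps hP)
      obtain ⟨f, hf⟩ := exists_orderEmbOfFin_comp S hS (h ∘ Sum.inl) fun a => by simp [hSdef]
      obtain ⟨g, hg⟩ := exists_orderEmbOfFin_comp Sᶜ (hcompl ⟨S, hS⟩) (h ∘ Sum.inr) fun b => by
        simpa [hSdef] using fun a => hPQ a b
      refine ⟨⟨⟨S, hS⟩, ⟨f, (comp_mem_linearMaps _ _).1 (hf ▸ hP)⟩,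
        ⟨g, (comp_mem_linearMaps _ _).1 (hg ▸ hQ)⟩⟩, Subtype.ext ?_⟩
      simp only [hf, hg]
      exact Sum.elim_comp_inl_inr h
  rw [← ncard_linearMaps, cl_disjointUnion, ← Nat.card_coe_set_eq,
    ← Nat.card_congr (Equiv.ofBijective _ hbij), Nat.card_prod, Nat.card_prod,
    Nat.card_coe_set_eq, Nat.card_coe_set_eq, ncard_linearMaps, ncard_linearMaps,
    Nat.card_eq_fintype_card, Fintype.card_finset_len, Fintype.card_fin]

end HeapOrderings

/-! ### Cointeraction of `Δ` and `δ`. -/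

section Cointeraction

variable {A : Type u}

/-- Open sets of `P / r` are the `r`-saturated open sets of `P`; this permits exchanging the sums
over `r` and over `O`. -/
theorem mem_opens_contract [Finite A] {P : Preorder A} {r : Setoid A} {O : Set A} :
    O ∈ opens (contract P r) ↔ O ∈ opens P ∧ ∀ x y, r x y → (x ∈ O ↔ y ∈ O) := by
  rw [mem_opens, mem_opens]
  constructor
  · exact fun h => ⟨fun x y hxy => h x y (le_contract P r hxy), fun x y hxy =>
      ⟨h x y (rel_contract P r hxy), h y x (rel_contract P r (r.symm hxy))⟩⟩
  · rintro ⟨h, h'⟩ x y hxy hx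
    induction hxy with
    | single hxy => exact hxy.elim (fun hxy => h _ _ hxy hx) fun hxy => (h' _ _ hxy).1 hx
    | tail _ hxy ih => exact hxy.elim (fun hxy => h _ _ hxy ih) fun hxy => (h' _ _ hxy).1 ih

theorem contract_restrict_le {P : Preorder A} {r : Setoid A} {S : Set A} {x y : S}
    (h : (contract (restrict P S) (r.comap Subtype.val)).le x y) : (contract P r).le x y :=
  Relation.TransGen.lift (r := fun x y : S => (restrict P S).le x y ∨ r.comap Subtype.val x y)
    (p := fun x y => P.le x y ∨ r x y) Subtype.val (fun _ _ h => h) _ _ h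

/-- Every step of a chain in `P / r` preserves membership in `O`, so a chain starting in `O` never
leaves it. -/
theorem restrict_contract_of_open {P : Preorder A} {r : Setoid A} {O : Set A}
    (hO : ∀ x y, P.le x y → x ∈ O → y ∈ O) (hr : ∀ x y, r x y → (x ∈ O ↔ y ∈ O)) :
    restrict (contract P r) O = contract (restrict P O) (r.comap Subtype.val) := by
  refine Preorder.ext fun x y => ⟨fun h => ?_, fun h => contract_restrict_le h⟩
  have key : ∀ y, (contract P r).le x y → ∃ hy : y ∈ O,
      (contract (restrict P O) (r.comap Subtype.val)).le x ⟨y, hy⟩ := by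
    intro y h
    induction h with
    | single h =>
      exact ⟨h.elim (fun h => hO _ _ h x.2) fun h => (hr _ _ h).1 x.2, Relation.TransGen.single h⟩
    | tail _ h ih =>
      obtain ⟨hb, ih⟩ := ih
      exact ⟨h.elim (fun h => hO _ _ h hb) fun h => (hr _ _ h).1 hb, Relation.TransGen.tail ih h⟩
  exact (key y h).2

/-- Here the complement is stable under predecessors, so the chain is followed backwards from its
end. -/
theorem restrict_contract_compl_of_open {P : Preorder A} {r : Setoid A} {O : Set A}
    (hO : ∀ x y, P.le x y → x ∈ O → y ∈ O) (hr : ∀ x y, r x y → (x ∈ O ↔ y ∈ O)) :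
    restrict (contract P r) Oᶜ = contract (restrict P Oᶜ) (r.comap Subtype.val) := by
  refine Preorder.ext fun x y => ⟨fun h => ?_, fun h => contract_restrict_le h⟩
  have key : ∀ x, (contract P r).le x y → ∃ hx : x ∈ Oᶜ,
      (contract (restrict P Oᶜ) (r.comap Subtype.val)).le ⟨x, hx⟩ y := by
    intro x h
    induction h using Relation.TransGen.head_induction_on with
    | single h =>
      exact ⟨fun hx => y.2 (h.elim (fun h => hO _ _ h hx) fun h => (hr _ _ h).1 hx),
        Relation.TransGen.single h⟩
    | head h _ ih =>
      obtain ⟨hb, ih⟩ := ih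
      exact ⟨fun hx => hb (h.elim (fun h => hO _ _ h hx) fun h => (hr _ _ h).1 hx),
        Relation.TransGen.head h ih⟩
  exact (key x h).2

theorem iso_restrictRel_of_saturated (P : Preorder A) {r : Setoid A} {O : Set A}
    (hr : ∀ x y, r x y → (x ∈ O ↔ y ∈ O)) :
    Iso (disjointUnion (restrictRel (restrict P O) (r.comap Subtype.val))
      (restrictRel (restrict P Oᶜ) (r.comap Subtype.val))) (restrictRel P r) :=
  iso_disjointUnion_restrict (restrictRel P r) O fun x y h => hr x y h.2

/-- By saturation each class of `r` lies on one side of `O`, and by openness so do two elements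
mutually comparable in `P / r`; both conditions of compatibility can therefore be checked on each
side. -/
theorem compatible_iff_of_open {P : Preorder A} {r : Setoid A} {O : Set A}
    (hO : ∀ x y, P.le x y → x ∈ O → y ∈ O) (hr : ∀ x y, r x y → (x ∈ O ↔ y ∈ O)) :
    Compatible P r ↔ Compatible (restrict P Oᶜ) (r.comap Subtype.val) ∧
      Compatible (restrict P O) (r.comap Subtype.val) := by
  have hopen : ∀ x y, (contract P r).le x y → x ∈ O → y ∈ O := by
    intro x y hxy hx
    induction hxy with
    | single hxy => exact hxy.elim (fun hxy => hO _ _ hxy hx) fun hxy => (hr _ _ hxy).1 hx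
    | tail _ hxy ih => exact hxy.elim (fun hxy => hO _ _ hxy ih) fun hxy => (hr _ _ hxy).1 ih
  simp only [compatible_iff]
  rw [← restrict_contract_of_open hO hr, ← restrict_contract_compl_of_open hO hr]
  constructor
  · rintro ⟨h1, h2⟩
    refine ⟨⟨fun x y hxy => ?_, fun x y hxy hyx => h2 x y hxy hyx⟩,
      ⟨fun x y hxy => ?_, fun x y hxy hyx => h2 x y hxy hyx⟩⟩
    · exact (comp_restrict (P := restrictRel P r) (S := Oᶜ)
        (fun a b hab => not_congr (hr a b hab.2)) (h1 hxy)).2 x.2 y.2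
    · exact (comp_restrict (P := restrictRel P r) (S := O)
        (fun a b hab => hr a b hab.2) (h1 hxy)).2 x.2 y.2
  · rintro ⟨⟨h1, h1'⟩, h2, h2'⟩
    refine ⟨fun x y hxy => ?_, fun x y hxy hyx => ?_⟩
    · by_cases hx : x ∈ O
      · exact comp_map (P := restrictRel (restrict P O) (r.comap Subtype.val))
          (Q := restrictRel P r) Subtype.val (fun _ _ h => h)
          (@h2 ⟨x, hx⟩ ⟨y, (hr x y hxy).1 hx⟩ hxy)
      · exact comp_map (P := restrictRel (restrict P Oᶜ) (r.comap Subtype.val))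
          (Q := restrictRel P r) Subtype.val (fun _ _ h => h)
          (@h1 ⟨x, hx⟩ ⟨y, fun hy => hx ((hr x y hxy).2 hy)⟩ hxy)
    · by_cases hx : x ∈ O
      · exact h2' ⟨x, hx⟩ ⟨y, hopen x y hxy hx⟩ hxy hyx
      · exact h1' ⟨x, hx⟩ ⟨y, fun hy => hx (hopen y x hyx hy)⟩ hxy hyx

/-- The equivalence on `A` with given restrictions to `O` and to its complement, for which `O` is
saturated. -/
def glueSetoid (O : Set A) (s : Setoid (Oᶜ : Set A)) (t : Setoid O) : Setoid A where
  r x y := (∃ (hx : x ∈ O) (hy : y ∈ O), t ⟨x, hx⟩ ⟨y, hy⟩) ∨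
    ∃ (hx : x ∉ O) (hy : y ∉ O), s ⟨x, hx⟩ ⟨y, hy⟩
  iseqv := by
    refine ⟨fun x => ?_, ?_, ?_⟩
    · by_cases hx : x ∈ O
      · exact Or.inl ⟨hx, hx, t.refl _⟩
      · exact Or.inr ⟨hx, hx, s.refl _⟩
    · rintro x y (⟨hx, hy, h⟩ | ⟨hx, hy, h⟩)
      · exact Or.inl ⟨hy, hx, t.symm h⟩
      · exact Or.inr ⟨hy, hx, s.symm h⟩
    · rintro x y z (⟨hx, hy, h⟩ | ⟨hx, hy, h⟩) (⟨hy', hz, h'⟩ | ⟨hy', hz, h'⟩)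
      · exact Or.inl ⟨hx, hz, t.trans h h'⟩
      · exact (hy' hy).elim
      · exact (hy hy').elim
      · exact Or.inr ⟨hx, hz, s.trans h h'⟩

theorem glueSetoid_iff {O : Set A} {s : Setoid (Oᶜ : Set A)} {t : Setoid O} {x y : A} :
    glueSetoid O s t x y ↔ (∃ (hx : x ∈ O) (hy : y ∈ O), t ⟨x, hx⟩ ⟨y, hy⟩) ∨
      ∃ (hx : x ∉ O) (hy : y ∉ O), s ⟨x, hx⟩ ⟨y, hy⟩ := Iff.rfl

theorem glueSetoid_saturated (O : Set A) (s : Setoid (Oᶜ : Set A)) (t : Setoid O) (x y : A)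
    (h : glueSetoid O s t x y) : x ∈ O ↔ y ∈ O := by
  rcases h with ⟨hx, hy, -⟩ | ⟨hx, hy, -⟩
  · exact iff_of_true hx hy
  · exact iff_of_false hx hy

theorem comap_glueSetoid (O : Set A) (s : Setoid (Oᶜ : Set A)) (t : Setoid O) :
    (glueSetoid O s t).comap (Subtype.val : O → A) = t := by
  ext x y
  rw [Setoid.comap_rel, glueSetoid_iff]
  exact ⟨fun h => h.elim (fun h => h.2.2) fun h => (h.1 x.2).elim, fun h => Or.inl ⟨x.2, y.2, h⟩⟩

theorem comap_compl_glueSetoid (O : Set A) (s : Setoid (Oᶜ : Set A)) (t : Setoid O) :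
    (glueSetoid O s t).comap (Subtype.val : (Oᶜ : Set A) → A) = s := by
  ext x y
  rw [Setoid.comap_rel, glueSetoid_iff]
  exact ⟨fun h => h.elim (fun h => (x.2 h.1).elim) fun h => h.2.2, fun h => Or.inr ⟨x.2, y.2, h⟩⟩

theorem glueSetoid_comap {O : Set A} {r : Setoid A} (hr : ∀ x y, r x y → (x ∈ O ↔ y ∈ O)) :
    glueSetoid O (r.comap Subtype.val) (r.comap Subtype.val) = r := by
  ext x y
  rw [glueSetoid_iff]
  constructor
  · rintro (⟨_, _, h⟩ | ⟨_, _, h⟩) <;> exact h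
  · intro h
    by_cases hx : x ∈ O
    · exact Or.inl ⟨hx, (hr x y h).1 hx, h⟩
    · exact Or.inr ⟨hx, fun hy => hx ((hr x y h).2 hy), h⟩

variable {K : Type*} [Field K]

open Classical in
/-- The cointeraction between `Δ` and `δ`: the action of a character preserves the compatibility
with `Δ`. -/
theorem isComultiplicative_act {φ : Hqp K →ₐ[K] K[X]} (χ : Mqp K)
    (hφ : IsComultiplicative fun (_ : Type v) _ P => φ (cls K P)) :
    IsComultiplicative fun (_ : Type v) _ P => act φ χ (cls K P) := by
  intro A _ P x y
  simp only [act_cls, eval_finsetSum, eval_mul, eval_C]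
  have h1 : ∑ r ∈ compatibles P, χ (cls K (restrictRel P r)) *
        (φ (cls K (contract P r))).eval (x + y) =
      ∑ r ∈ compatibles P, ∑ O ∈ opens (contract P r), χ (cls K (restrictRel P r)) *
        ((φ (cls K (restrict (contract P r) Oᶜ))).eval x *
          (φ (cls K (restrict (contract P r) O))).eval y) :=
    Finset.sum_congr rfl fun r _ => by rw [hφ, Finset.mul_sum]
  -- The open set is now chosen first, and `r` ranges over the compatible equivalences that saturate
  -- it.
  rw [h1, Finset.sum_comm' (t' := opens P)
    (s' := fun O => (compatibles P).filter fun r => ∀ x y, r x y → (x ∈ O ↔ y ∈ O))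
    fun r O => by rw [mem_opens_contract, Finset.mem_filter]; tauto]
  refine Finset.sum_congr rfl fun O hO => ?_
  rw [mem_opens] at hO
  rw [Finset.sum_mul_sum, ← Finset.sum_product']
  -- Such an `r` amounts to a compatible equivalence on each of the two sides, through restriction
  -- and gluing.
  refine Finset.sum_nbij'
    (fun r => (r.comap (Subtype.val : (Oᶜ : Set A) → A), r.comap (Subtype.val : O → A)))
    (fun p => glueSetoid O p.1 p.2) ?_ ?_ ?_ ?_ ?_
  · intro r hr
    rw [Finset.mem_filter, mem_compatibles] at hr
    rw [Finset.mem_product, mem_compatibles, mem_compatibles]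
    exact (compatible_iff_of_open hO hr.2).1 hr.1
  · rintro ⟨s, t⟩ hst
    rw [Finset.mem_product, mem_compatibles, mem_compatibles] at hst
    rw [Finset.mem_filter, mem_compatibles]
    refine ⟨(compatible_iff_of_open hO (glueSetoid_saturated O s t)).2 ?_,
      glueSetoid_saturated O s t⟩
    rwa [comap_glueSetoid, comap_compl_glueSetoid]
  · intro r hr
    rw [Finset.mem_filter] at hr
    exact glueSetoid_comap hr.2
  · rintro ⟨s, t⟩ _
    exact Prod.ext (comap_compl_glueSetoid O s t) (comap_glueSetoid O s t)
  · intro r hr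
    rw [Finset.mem_filter] at hr
    -- Saturation splits `P | r` into a disjoint union, on which `χ` is multiplicative.
    rw [← cls_congr K (iso_restrictRel_of_saturated P hr.2), cls_disjointUnion, map_mul,
      restrict_contract_of_open hO hr.2, restrict_contract_compl_of_open hO hr.2]
    ring

end Cointeraction

/-! ### Counits, and algebra morphisms built from multiplicative maps. -/

section Counits

variable (K : Type u) [Field K]

theorem map_one_of_isEmpty {f : Hqp K →ₗ[K] K[X]}
    (h : ∀ (A : Type) [IsEmpty A] (P : Preorder A), f (cls K P) = 1) : f 1 = 1 := by
  rw [← cls_of_isEmpty K (block 0), h]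

/-- A linear map on `H_qp`, multiplicative on quasi-posets, is an algebra morphism. -/
theorem exists_algHom {f : Hqp K →ₗ[K] K[X]}
    (h1 : ∀ (A : Type) [IsEmpty A] (P : Preorder A), f (cls K P) = 1)
    (hmul : ∀ (A B : Type) [Finite A] [Finite B] (P : Preorder A) (Q : Preorder B),
      f (cls K (disjointUnion P Q)) = f (cls K P) * f (cls K Q)) :
    ∃ φ : Hqp K →ₐ[K] K[X], φ.toLinearMap = f := by
  refine ⟨homOfMul K (fun q => f (MonoidAlgebra.of K Qp q)) ?_ ?_, linearMap_ext fun n P => ?_⟩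
  · rw [map_one]
    exact map_one_of_isEmpty K h1
  · intro a b
    induction a using Qp.ind with | h n P
    induction b using Qp.ind with | h m Q
    rw [isoclass_mul]
    exact hmul _ _ P Q
  · exact homOfMul_cls K _ _ _ P

variable {A : Type v} [Finite A] (P : Preorder A)

theorem isoclass_eq_one_iff {P : Preorder A} : isoclass P = 1 ↔ IsEmpty A := by
  rw [one_eq_isoclass, isoclass_eq_iff]
  constructor
  · rintro ⟨e, -⟩
    exact e.isEmpty
  · intro h
    exact iso_of_isEmpty _ _

theorem eps_of_nonempty [Nonempty A] : eps K (cls K P) = 0 := by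
  rw [eps, linearLift_cls, if_neg]
  simp [isoclass_eq_one_iff]

theorem eps_of_isEmpty [IsEmpty A] : eps K (cls K P) = 1 := by
  rw [eps, linearLift_cls, if_pos (isoclass_eq_one_iff.2 inferInstance)]

open Classical in
theorem eps'_cls : eps' K (cls K P) = if IsDiscrete P then 1 else 0 := by
  obtain ⟨n, Q, h⟩ := exists_fin_iso P
  rw [cls_congr K h, eps', linearLift_cls, Qp.lift_fin]
  exact if_congr ⟨h.symm.isDiscrete, h.isDiscrete⟩ rfl rfl

end Counits

/-! ### The invariants `cl`, `cc` and `μ / cl!` on isoclasses. -/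

section Invariants

/-- The number of classes of an isoclass. -/
noncomputable def Qp.cl : Qp → ℕ :=
  Qp.lift (fun _ P => QuasiPoset.cl P) fun _ _ _ _ h => cl_congr h

/-- The number of connected components of an isoclass. -/
noncomputable def Qp.cc : Qp → ℕ :=
  Qp.lift (fun _ P => QuasiPoset.cc P) fun _ _ _ _ h => cc_congr h

/-- The number of heap-orderings of an isoclass. -/
noncomputable def Qp.heapOrderings : Qp → ℕ :=
  Qp.lift (fun _ P => QuasiPoset.heapOrderings P) fun _ _ _ _ h => heapOrderings_congr h

variable {A : Type v} [Finite A] (P : Preorder A)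

theorem Qp.cl_isoclass : (isoclass P).cl = QuasiPoset.cl P := by
  obtain ⟨n, Q, h⟩ := exists_fin_iso P
  rw [isoclass_eq_iff.2 h, cl_congr h, Qp.cl, Qp.lift_fin]

theorem Qp.cc_isoclass : (isoclass P).cc = QuasiPoset.cc P := by
  obtain ⟨n, Q, h⟩ := exists_fin_iso P
  rw [isoclass_eq_iff.2 h, cc_congr h, Qp.cc, Qp.lift_fin]

theorem Qp.heapOrderings_isoclass :
    (isoclass P).heapOrderings = QuasiPoset.heapOrderings P := by
  obtain ⟨n, Q, h⟩ := exists_fin_iso P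
  rw [isoclass_eq_iff.2 h, heapOrderings_congr h, Qp.heapOrderings, Qp.lift_fin]

theorem Qp.cl_one : (1 : Qp).cl = 0 := by
  rw [one_eq_isoclass, Qp.cl_isoclass]
  exact cl_eq_zero_iff.2 inferInstance

theorem Qp.cc_one : (1 : Qp).cc = 0 := by
  rw [one_eq_isoclass, Qp.cc_isoclass]
  exact cc_eq_zero_iff.2 inferInstance

theorem Qp.cl_mul (a b : Qp) : (a * b).cl = a.cl + b.cl := by
  induction a using Qp.ind with | h n P
  induction b using Qp.ind with | h m Q
  rw [isoclass_mul, Qp.cl_isoclass, Qp.cl_isoclass, Qp.cl_isoclass, cl_disjointUnion]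

theorem Qp.cc_mul (a b : Qp) : (a * b).cc = a.cc + b.cc := by
  induction a using Qp.ind with | h n P
  induction b using Qp.ind with | h m Q
  rw [isoclass_mul, Qp.cc_isoclass, Qp.cc_isoclass, Qp.cc_isoclass, cc_disjointUnion]

variable (K : Type u) [Field K]

/-- `μ_P / cl(P)!`. -/
noncomputable def Qp.heapRatio (q : Qp) : K := (q.heapOrderings : K) / (q.cl.factorial : K)

theorem Qp.heapRatio_isoclass : (isoclass P).heapRatio K =
    (QuasiPoset.heapOrderings P : K) / ((QuasiPoset.cl P).factorial : K) := by
  rw [Qp.heapRatio, Qp.heapOrderings_isoclass, Qp.cl_isoclass]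

variable [CharZero K]

theorem Qp.heapRatio_of_isDiscrete {P : Preorder A} (h : IsDiscrete P) :
    (isoclass P).heapRatio K = 1 := by
  rw [Qp.heapRatio_isoclass, heapOrderings_of_isDiscrete h, div_self]
  exact_mod_cast Nat.factorial_ne_zero _

theorem Qp.heapRatio_one : (1 : Qp).heapRatio K = 1 :=
  Qp.heapRatio_of_isDiscrete K fun _ _ _ => trivial

/-- The number of shuffles is a binomial coefficient, which division by `cl!` absorbs. -/
theorem Qp.heapRatio_mul (a b : Qp) :
    (a * b).heapRatio K = a.heapRatio K * b.heapRatio K := by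
  rw [Qp.heapRatio, Qp.heapRatio, Qp.heapRatio, Qp.cl_mul]
  induction a using Qp.ind with | h n P
  induction b using Qp.ind with | h m Q
  rw [isoclass_mul, Qp.heapOrderings_isoclass, Qp.heapOrderings_isoclass,
    Qp.heapOrderings_isoclass, Qp.cl_isoclass, Qp.cl_isoclass, heapOrderings_disjointUnion,
    Nat.cast_mul, Nat.cast_mul, Nat.cast_add_choose]
  have h1 : ((QuasiPoset.cl P).factorial : K) ≠ 0 := by exact_mod_cast Nat.factorial_ne_zero _
  have h2 : ((QuasiPoset.cl Q).factorial : K) ≠ 0 := by exact_mod_cast Nat.factorial_ne_zero _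
  have h3 : ((QuasiPoset.cl P + QuasiPoset.cl Q).factorial : K) ≠ 0 := by
    exact_mod_cast Nat.factorial_ne_zero _
  field_simp

end Invariants

/-! ### The morphism `φ₀` and the Ehrhart morphisms. -/

section Morphisms

variable (K : Type u) [Field K] [CharZero K]

/-- The character `λ`. -/
noncomputable def lamHom : Mqp K :=
  homOfMul K (Qp.heapRatio K) (Qp.heapRatio_one K) (Qp.heapRatio_mul K)

/-- The character `P ↦ (-1) ^ (cl P + cc P) * λ_P`. -/
noncomputable def betaHom : Mqp K :=
  homOfMul K (fun q => (-1) ^ (q.cl + q.cc) * q.heapRatio K)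
    (by rw [Qp.cl_one, Qp.cc_one, Qp.heapRatio_one, add_zero, pow_zero, one_mul])
    fun a b => by
      rw [Qp.cl_mul, Qp.cc_mul, Qp.heapRatio_mul]
      ring

/-- The homogeneous morphism `φ₀`. -/
noncomputable def phiZero : Hqp K →ₐ[K] K[X] :=
  homOfMul K (fun q => C (q.heapRatio K) * X ^ q.cl)
    (by rw [Qp.heapRatio_one, Qp.cl_one, map_one, pow_zero, one_mul])
    fun a b => by
      rw [Qp.heapRatio_mul, Qp.cl_mul, map_mul]
      ring

variable {A : Type v} [Finite A] (P : Preorder A)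

theorem lamHom_cls :
    lamHom K (cls K P) = (heapOrderings P : K) / ((cl P).factorial : K) := by
  rw [lamHom, homOfMul_cls, Qp.heapRatio_isoclass]

theorem lamHom_of_isDiscrete {P : Preorder A} (h : IsDiscrete P) : lamHom K (cls K P) = 1 := by
  rw [lamHom, homOfMul_cls, Qp.heapRatio_of_isDiscrete K h]

theorem betaHom_cls : betaHom K (cls K P) = (-1) ^ (cl P + cc P) * lamHom K (cls K P) := by
  rw [betaHom, homOfMul_cls, lamHom, homOfMul_cls, Qp.cl_isoclass, Qp.cc_isoclass]

theorem phiZero_cls : phiZero K (cls K P) = C (lamHom K (cls K P)) * X ^ cl P := by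
  rw [phiZero, homOfMul_cls, lamHom, homOfMul_cls, Qp.cl_isoclass]

theorem ehrMap_cls : ehrMap K (cls K P) = (ehr P).map (algebraMap ℚ K) := by
  obtain ⟨n, Q, h⟩ := exists_fin_iso P
  rw [cls_congr K h, ehr_congr h, ehrMap, linearLift_cls, Qp.lift_fin]

theorem ehrStrMap_cls : ehrStrMap K (cls K P) = (ehrStr P).map (algebraMap ℚ K) := by
  obtain ⟨n, Q, h⟩ := exists_fin_iso P
  rw [cls_congr K h, ehrStr_congr h, ehrStrMap, linearLift_cls, Qp.lift_fin]

theorem exists_ehrHom : ∃ φ : Hqp K →ₐ[K] K[X], φ.toLinearMap = ehrMap K :=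
  exists_algHom K (fun A _ P => by rw [ehrMap_cls, ehr_of_isEmpty, Polynomial.map_one])
    fun A B _ _ P Q => by
      rw [ehrMap_cls, ehrMap_cls, ehrMap_cls, ehr_disjointUnion, Polynomial.map_mul]

theorem exists_ehrStrHom : ∃ φ : Hqp K →ₐ[K] K[X], φ.toLinearMap = ehrStrMap K :=
  exists_algHom K (fun A _ P => by rw [ehrStrMap_cls, ehrStr_of_isEmpty, Polynomial.map_one])
    fun A B _ _ P Q => by
      rw [ehrStrMap_cls, ehrStrMap_cls, ehrStrMap_cls, ehrStr_disjointUnion, Polynomial.map_mul]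

theorem ehrMap_eval_nat (k : ℕ) : (ehrMap K (cls K P)).eval (k : K) = (L P k).ncard := by
  rw [ehrMap_cls, eval_natCast_map, ehr_eval, map_natCast]

theorem ehrStrMap_eval_nat (k : ℕ) :
    (ehrStrMap K (cls K P)).eval (k : K) = (LStr P k).ncard := by
  rw [ehrStrMap_cls, eval_natCast_map, ehrStr_eval, map_natCast]

theorem isComultiplicative_ehrMap :
    IsComultiplicative fun (_ : Type v) _ P => ehrMap K (cls K P) := by
  refine isComultiplicative_of_nat fun A _ P k l => ?_
  rw [← Nat.cast_add, ehrMap_eval_nat, ncard_L_add]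
  simp only [ehrMap_eval_nat]
  push_cast
  rfl

theorem isComultiplicative_ehrStrMap :
    IsComultiplicative fun (_ : Type v) _ P => ehrStrMap K (cls K P) := by
  refine isComultiplicative_of_nat fun A _ P k l => ?_
  rw [← Nat.cast_add, ehrStrMap_eval_nat, ncard_LStr_add]
  simp only [ehrStrMap_eval_nat]
  push_cast
  rfl

/-- The binomial expansion of `(x + y) ^ cl P` is matched with the open sets grouped by `(cl Oᶜ, cl
O)`; within each group `heapOrderings_eq_sum` gives the coefficient. -/
theorem isComultiplicative_phiZero :
    IsComultiplicative fun (_ : Type v) _ P => phiZero K (cls K P) := by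
  classical
  intro A _ P x y
  simp only [phiZero_cls, eval_mul, eval_C, eval_pow, eval_X]
  rw [(Commute.all x y).add_pow', Finset.mul_sum,
    ← Finset.sum_fiberwise_of_maps_to (t := Finset.HasAntidiagonal.antidiagonal (cl P))
      (g := fun O => (cl (restrict P Oᶜ), cl (restrict P O))) fun O hO =>
        Finset.HasAntidiagonal.mem_antidiagonal.2 (cl_add_cl_compl P O (mem_opens.1 hO))]
  refine Finset.sum_congr rfl fun p hp => ?_
  rw [lamHom_cls, heapOrderings_eq_sum P hp, Nat.cast_sum, Finset.sum_div, Finset.sum_mul]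
  refine Finset.sum_congr rfl fun O hO => ?_
  rw [Finset.mem_filter] at hO
  rw [lamHom_cls, lamHom_cls, ← hO.2, ← cl_add_cl_compl P O (mem_opens.1 hO.1), nsmul_eq_mul,
    Nat.cast_add_choose]
  have h1 : ((cl (restrict P O)).factorial : K) ≠ 0 := by
    exact_mod_cast Nat.factorial_ne_zero _
  have h2 : ((cl (restrict P Oᶜ)).factorial : K) ≠ 0 := by
    exact_mod_cast Nat.factorial_ne_zero _
  have h3 : ((cl (restrict P Oᶜ) + cl (restrict P O)).factorial : K) ≠ 0 := by
    exact_mod_cast Nat.factorial_ne_zero _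
  push_cast
  field_simp

theorem isHopfMorphism_phiZero : IsHopfMorphism (phiZero K) where
  comul := comul_of_isComultiplicative (f := (phiZero K).toLinearMap) (isComultiplicative_phiZero K)
  counit x := by
    refine LinearMap.congr_fun (f := (leval 0) ∘ₗ (phiZero K).toLinearMap) (linearMap_ext ?_) x
    intro n P
    rcases isEmpty_or_nonempty (Fin n) with h | h
    · simp [cls_of_isEmpty, leval]
      rw [← cls_of_isEmpty K P, eps_of_isEmpty]
    · rw [eps_of_nonempty]
      simp [phiZero_cls, leval, (cl_pos P).ne']

theorem isPhiZero_phiZero : IsPhiZero (phiZero K) where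
  hopf := isHopfMorphism_phiZero K
  homogeneous n P := by
    rw [phiZero_cls, ← smul_eq_C_mul]
    exact Submodule.smul_mem _ _ (Submodule.mem_span_singleton_self _)
  block n hn := by
    rw [phiZero_cls, cl_block hn, lamHom_of_isDiscrete K fun _ _ _ => trivial, map_one, one_mul,
      pow_one]

end Morphisms

/-! ### Uniqueness of `φ₀`. -/

section Uniqueness

variable {K : Type u} [Field K]

/-- In the expansion at `x + y`, the terms `O = ∅` and `O = A` give the values of `P` at `x` and at
`y`. All other terms involve proper restrictions only and cancel in the difference. -/
theorem additive_sub_of_restrict {f g : Hqp K →ₗ[K] K[X]}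
    (hf : IsComultiplicative fun (_ : Type v) _ P => f (cls K P))
    (hg : IsComultiplicative fun (_ : Type v) _ P => g (cls K P)) (hf1 : f 1 = 1) (hg1 : g 1 = 1)
    {A : Type v} [Finite A] [Nonempty A] (P : Preorder A)
    (h : ∀ S : Set A, S ≠ Set.univ → f (cls K (restrict P S)) = g (cls K (restrict P S)))
    (x y : K) : (f (cls K P) - g (cls K P)).eval (x + y) =
      (f (cls K P) - g (cls K P)).eval x + (f (cls K P) - g (cls K P)).eval y := by
  classical
  have h1 : ∀ {f : Hqp K →ₗ[K] K[X]}, IsComultiplicative (fun (_ : Type v) _ P => f (cls K P)) →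
      f 1 = 1 → (f (cls K P)).eval (x + y) = (f (cls K P)).eval x + (f (cls K P)).eval y +
        ∑ O ∈ ((opens P).erase Set.univ).erase ∅,
          (f (cls K (restrict P Oᶜ))).eval x * (f (cls K (restrict P O))).eval y := by
    intro f hf hf1
    rw [hf, ← Finset.add_sum_erase _ _ (univ_mem_opens P), ← Finset.add_sum_erase _ _
      (Finset.mem_erase.2 ⟨Set.empty_ne_univ, empty_mem_opens P⟩), ← add_assoc]
    have e1 : Iso (restrict P (∅ : Set A)ᶜ) P :=
      ⟨(Equiv.setCongr Set.compl_empty).trans (Equiv.Set.univ A), fun _ _ => Iff.rfl⟩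
    have e2 : IsEmpty ((Set.univ : Set A)ᶜ : Set A) := by simp
    beta_reduce
    rw [cls_congr K e1, cls_congr K (iso_restrict_univ P),
      cls_of_isEmpty K (restrict P Set.univᶜ), cls_of_isEmpty K (restrict P ∅), hf1]
    simp [add_comm]
  have h2 : ∀ O ∈ ((opens P).erase Set.univ).erase ∅,
      (f (cls K (restrict P Oᶜ))).eval x * (f (cls K (restrict P O))).eval y =
        (g (cls K (restrict P Oᶜ))).eval x * (g (cls K (restrict P O))).eval y := by
    intro O hO
    rw [Finset.mem_erase, Finset.mem_erase] at hO
    rw [h O hO.2.1, h Oᶜ fun h => hO.1 (by simpa using h)]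
  rw [eval_sub, eval_sub, eval_sub, h1 hf hf1, h1 hg hg1, Finset.sum_congr rfl h2]
  ring

theorem exists_eq_of_isHomogeneous {φ : Hqp K →ₐ[K] K[X]} (hφ : IsHomogeneous φ) {A : Type v}
    [Finite A] (P : Preorder A) : ∃ c, φ (cls K P) = C c * X ^ cl P := by
  obtain ⟨n, Q, h⟩ := exists_fin_iso P
  obtain ⟨c, hc⟩ := Submodule.mem_span_singleton.1 (hφ n Q)
  exact ⟨c, by rw [cls_congr K h, cl_congr h, ← hc, smul_eq_C_mul]⟩

/-- By induction on the cardinality the difference at `P` is a multiple of `X`. Homogeneity of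
degree `cl P` kills it unless `cl P = 1`, and then `P` is a block, where the value is prescribed. -/
theorem IsPhiZero.unique [CharZero K] {φ ψ : Hqp K →ₐ[K] K[X]} (hφ : IsPhiZero φ)
    (hψ : IsPhiZero ψ) : φ = ψ := by
  suffices h : ∀ (A : Type) [Finite A] (P : Preorder A), φ (cls K P) = ψ (cls K P) from
    algHom_ext_cls fun n P => h _ P
  intro A _ P
  induction hn : Nat.card A using Nat.strong_induction_on generalizing A with
  | _ n ih =>
    subst hn
    rcases isEmpty_or_nonempty A with h | h
    · rw [cls_of_isEmpty, map_one, map_one]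
    have hadd := eq_smul_X_of_additive (additive_sub_of_restrict
      (isComultiplicative_of_comul hφ.hopf.comul) (isComultiplicative_of_comul hψ.hopf.comul)
      (map_one φ) (map_one ψ) P fun S hS => ih _ (card_restrict_lt hS) S (restrict P S) rfl)
    simp only [AlgHom.toLinearMap_apply] at hadd
    obtain ⟨c, hc⟩ := exists_eq_of_isHomogeneous hφ.homogeneous P
    obtain ⟨d, hd⟩ := exists_eq_of_isHomogeneous hψ.homogeneous P
    by_cases h1 : cl P = 1
    · obtain ⟨n, hn, hiso⟩ := iso_block_of_cl_eq_one h1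
      rw [cls_congr K hiso, hφ.block n hn, hψ.block n hn]
    · have hcoeff := congrArg (fun p : K[X] => p.coeff 1) hadd
      simp only [hc, hd, coeff_sub, coeff_C_mul, coeff_X_pow, Ne.symm h1, if_false, mul_zero,
        sub_zero, coeff_X_one, mul_one] at hcoeff
      rw [hc, hd, ← hcoeff, map_zero, zero_mul] at hadd
      rw [hc, hd, sub_eq_zero.1 hadd]

end Uniqueness

/-! ### Lowest coefficients and transitivity of the action on `φ₀`. -/

section Action

variable {K : Type u} [Field K]

theorem Compatible.eq_comp_of_discrete {A : Type v} {P : Preorder A} {r : Setoid A}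
    (h : Compatible P r) (hP : IsDiscrete P) : r = comp P :=
  le_antisymm h.le_comp (comp_le fun x y hxy =>
    h.eq_of_contract x y (le_contract P r hxy) (le_contract P r (hP x y hxy)))

theorem compatibles_of_isDiscrete {A : Type v} [Finite A] {P : Preorder A} (hP : IsDiscrete P) :
    compatibles P = {comp P} := by
  ext r
  rw [mem_compatibles, Finset.mem_singleton]
  exact ⟨fun h => h.eq_comp_of_discrete hP, fun h => h ▸ compatible_comp P⟩

theorem act_one (φ : Hqp K →ₐ[K] K[X]) (χ : Mqp K) : act φ χ 1 = 1 := by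
  rw [← cls_of_isEmpty K (block 0), act_cls, compatibles_of_isDiscrete fun _ _ _ => trivial,
    Finset.sum_singleton, cls_of_isEmpty, cls_of_isEmpty, map_one, map_one, map_one, one_mul]

/-- Each connected component contributes a polynomial without constant term, hence a factor `X`. -/
theorem X_pow_cc_dvd {φ : Hqp K →ₐ[K] K[X]} (hφ : ∀ x, (φ x).eval 0 = eps K x)
    (A : Type v) [Finite A] (P : Preorder A) : X ^ cc P ∣ φ (cls K P) := by
  refine induction_connected (motive := fun A _ P => X ^ cc P ∣ φ (cls K P)) ?_ ?_ ?_ ?_ A P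
  · intro A B _ _ P Q h
    rw [cc_congr h, cls_congr K h]
    exact id
  · intro A _ P h
    rw [cc_eq_zero_iff.2 h, pow_zero]
    exact one_dvd _
  · intro A _ P h
    have : Nonempty A := by
      rw [← not_isEmpty_iff, ← cc_eq_zero_iff (P := P), h]
      exact one_ne_zero
    rw [h, pow_one, X_dvd_iff, coeff_zero_eq_eval_zero, hφ, eps_of_nonempty]
  · intro A B _ _ P Q hP hQ
    rw [cc_disjointUnion, cls_disjointUnion, map_mul, pow_add]
    exact mul_dvd_mul hP hQ

/-- The character sending `P` to the coefficient of `X ^ cc P` in `φ P`. -/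
noncomputable def lowestCoeff (φ : Hqp K →ₐ[K] K[X]) (hφ : ∀ x, (φ x).eval 0 = eps K x) :
    Mqp K :=
  homOfMul K (fun q => (φ (MonoidAlgebra.of K Qp q)).coeff q.cc)
    (by rw [map_one, map_one, Qp.cc_one, coeff_one_zero])
    fun a b => by
      rw [map_mul, map_mul, Qp.cc_mul]
      induction a using Qp.ind with | h n P
      induction b using Qp.ind with | h m Q
      rw [Qp.cc_isoclass, Qp.cc_isoclass]
      -- Since `φ(P)` and `φ(Q)` are divisible by `X ^ cc P` and `X ^ cc Q`, the coefficient of the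
      -- product at the total exponent is the product of the two coefficients.
      obtain ⟨p, hp⟩ := X_pow_cc_dvd hφ _ P
      obtain ⟨q, hq⟩ := X_pow_cc_dvd hφ _ Q
      rw [cls] at hp hq
      rw [hp, hq, mul_mul_mul_comm, ← pow_add]
      simp [coeff_X_pow_mul']

theorem lowestCoeff_cls {φ : Hqp K →ₐ[K] K[X]} (hφ : ∀ x, (φ x).eval 0 = eps K x)
    {A : Type v} [Finite A] (P : Preorder A) :
    lowestCoeff φ hφ (cls K P) = (φ (cls K P)).coeff (cc P) := by
  rw [lowestCoeff, homOfMul_cls, Qp.cc_isoclass]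
  rfl

variable [CharZero K]

theorem act_phiZero_cls (χ : Mqp K) {A : Type v} [Finite A] (P : Preorder A) :
    act (phiZero K) χ (cls K P) = ∑ r ∈ compatibles P,
      C (χ (cls K (restrictRel P r)) * lamHom K (cls K (contract P r))) *
        X ^ Nat.card (Quotient r) := by
  rw [act_cls]
  refine Finset.sum_congr rfl fun r hr => ?_
  rw [phiZero_cls, (mem_compatibles.1 hr).cl_contract, map_mul, mul_assoc]

theorem coeff_act_phiZero_of_lt (χ : Mqp K) {A : Type v} [Finite A] (P : Preorder A) {j : ℕ}
    (hj : j < cc P) : (act (phiZero K) χ (cls K P)).coeff j = 0 := by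
  rw [act_phiZero_cls, finsetSum_coeff]
  refine Finset.sum_eq_zero fun r hr => ?_
  rw [coeff_C_mul, coeff_X_pow, if_neg, mul_zero]
  by_cases h : r = comp P
  · rw [h, ← cc_eq]
    exact hj.ne
  · exact (hj.trans ((mem_compatibles.1 hr).cc_lt h)).ne

/-- Only the partition into components has as few as `cc P` classes; its term carries `χ(P)` times
the value of `λ` on a discrete quasi-poset, which is 1. -/
theorem coeff_act_phiZero (χ : Mqp K) {A : Type v} [Finite A] (P : Preorder A) :
    (act (phiZero K) χ (cls K P)).coeff (cc P) = χ (cls K P) := by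
  rw [act_phiZero_cls, finsetSum_coeff, Finset.sum_eq_single (comp P)]
  · rw [coeff_C_mul, coeff_X_pow, if_pos (cc_eq P), mul_one, restrictRel_comp,
      lamHom_of_isDiscrete K (isDiscrete_contract_comp P), mul_one]
  · intro r hr h
    rw [coeff_C_mul, coeff_X_pow, if_neg ((mem_compatibles.1 hr).cc_lt h).ne, mul_zero]
  · exact fun h => (h (mem_compatibles.2 (compatible_comp P))).elim

/-- Every morphism from `H_qp` to `K[X]` compatible with the coproducts `Δ` is obtained from `φ₀` by
the action of a character. -/
theorem act_phiZero_lowestCoeff {φ : Hqp K →ₐ[K] K[X]}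
    (hφ : IsComultiplicative fun (_ : Type) _ P => φ (cls K P))
    (hφ0 : ∀ x, (φ x).eval 0 = eps K x) :
    act (phiZero K) (lowestCoeff φ hφ0) = φ.toLinearMap := by
  suffices h : ∀ (A : Type) [Finite A] (P : Preorder A),
      φ.toLinearMap (cls K P) = act (phiZero K) (lowestCoeff φ hφ0) (cls K P) from
    linearMap_ext fun n P => (h _ P).symm
  intro A _ P
  induction hn : Nat.card A using Nat.strong_induction_on generalizing A with
  | _ n ih =>
    subst hn
    rcases isEmpty_or_nonempty A with h | h
    · rw [cls_of_isEmpty, act_one]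
      exact map_one φ
    have hadd := eq_smul_X_of_additive (additive_sub_of_restrict (f := φ.toLinearMap) hφ
      (isComultiplicative_act (lowestCoeff φ hφ0) (isComultiplicative_phiZero K))
      (map_one φ) (act_one _ _) P fun S hS => ih _ (card_restrict_lt hS) S (restrict P S) rfl)
    have hcoeff := congrArg (fun p : K[X] => p.coeff 1) hadd
    simp only [coeff_sub, coeff_C_mul, coeff_X_one, mul_one] at hcoeff
    -- The difference is a multiple of `X`, so only this coefficient matters. For connected `P` the
    -- choice of character makes it agree; with more components it vanishes on both sides.
    have h1 : (φ.toLinearMap (cls K P)).coeff 1 =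
        (act (phiZero K) (lowestCoeff φ hφ0) (cls K P)).coeff 1 := by
      rcases Nat.lt_trichotomy (cc P) 1 with h1 | h1 | h1
      · exact (not_isEmpty_of_nonempty A (cc_eq_zero_iff.1 (Nat.lt_one_iff.1 h1))).elim
      · have := coeff_act_phiZero (lowestCoeff φ hφ0) P
        rw [lowestCoeff_cls, h1] at this
        exact this.symm
      · rw [coeff_act_phiZero_of_lt _ _ h1]
        obtain ⟨p, hp⟩ := X_pow_cc_dvd hφ0 _ P
        rw [AlgHom.toLinearMap_apply, hp, coeff_X_pow_mul', if_neg h1.not_ge]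
    rw [← hcoeff, h1, sub_self, map_zero, zero_mul] at hadd
    exact sub_eq_zero.1 hadd

theorem toLinearMap_eq_act_phiZero_iff {φ : Hqp K →ₐ[K] K[X]}
    (hφ0 : ∀ x, (φ x).eval 0 = eps K x)
    (hφ : IsComultiplicative fun (_ : Type) _ P => φ (cls K P)) (χ : Mqp K) :
    φ.toLinearMap = act (phiZero K) χ ↔ χ = lowestCoeff φ hφ0 := by
  constructor
  · intro h
    refine algHom_ext_cls fun n P => ?_
    rw [lowestCoeff_cls, ← coeff_act_phiZero χ P, ← h, AlgHom.toLinearMap_apply]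
  · rintro rfl
    exact (act_phiZero_lowestCoeff hφ hφ0).symm

end Action

/-! ### Discreteness by counting, and cancellation for convolution. -/

section Inverse

variable {K : Type u} [Field K]

/-- `∼_P` refines the component relation, and nested equivalences on a finite set with equally many
classes coincide. -/
theorem isDiscrete_iff {A : Type v} [Finite A] {P : Preorder A} :
    IsDiscrete P ↔ cc P = cl P := by
  refine ⟨fun h => h.cc_eq_cl, fun h => ?_⟩
  have hle : sim P ≤ comp P := fun x y hxy => comp_of_le hxy.1
  have heq : sim P = comp P := by
    by_contra hne
    have := card_quotient_lt (lt_of_le_of_ne hle hne)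
    rw [← cc_eq, ← cl_eq, h] at this
    exact this.false
  intro x y hxy
  have : sim P x y := by
    rw [heq]
    exact comp_of_le hxy
  exact this.2

theorem neg_one_pow_cl_add_cc {A : Type v} [Finite A] {P : Preorder A} (h : IsDiscrete P) :
    (-1 : K) ^ (cl P + cc P) = 1 := by
  rw [h.cc_eq_cl, ← two_mul, pow_mul]
  norm_num

theorem eval_zero_eq_eps {φ : Hqp K →ₐ[K] K[X]}
    (h : ∀ (A : Type) [Finite A] [Nonempty A] (P : Preorder A), (φ (cls K P)).eval 0 = 0)
    (x : Hqp K) : (φ x).eval 0 = eps K x := by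
  refine LinearMap.congr_fun (f := (leval 0) ∘ₗ φ.toLinearMap) (linearMap_ext ?_) x
  intro n P
  rcases isEmpty_or_nonempty (Fin n) with hn | hn
  · rw [eps_of_isEmpty, cls_of_isEmpty]
    simp [leval]
  · rw [eps_of_nonempty]
    exact h _ P

/-- Left cancellation in the monoid of characters. -/
theorem eq_of_conv_eq {α χ χ' : Mqp K}
    (hα : ∀ (A : Type) [Finite A] (P : Preorder A), IsDiscrete P → α (cls K P) ≠ 0)
    (h : conv α χ = conv α χ') : χ = χ' := by
  classical
  suffices h : ∀ (A : Type) [Finite A] (P : Preorder A), χ (cls K P) = χ' (cls K P) from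
    algHom_ext_cls fun n P => h _ P
  intro A _ P
  -- The induction is on the number of related pairs: `P | r` has the same underlying set as `P`,
  -- but strictly fewer relations unless `r` is the component relation.
  induction hn : Nat.card {p : A × A // P.le p.1 p.2} using Nat.strong_induction_on
    generalizing P with
  | _ n ih =>
    subst hn
    have h1 := LinearMap.congr_fun h (cls K P)
    have hmem := mem_compatibles.2 (compatible_comp P)
    rw [conv_cls, conv_cls, ← Finset.add_sum_erase _ _ hmem, ← Finset.add_sum_erase _ _ hmem,
      restrictRel_comp, Finset.sum_congr rfl fun r hr => ?_, add_left_inj] at h1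
    -- Only the term of the component relation is left: `α` of a discrete quasi-poset, nonzero by
    -- hypothesis, times the unknown value at `P`.
    · exact mul_left_cancel₀ (hα _ _ (isDiscrete_contract_comp P)) h1
    · rw [Finset.mem_erase, mem_compatibles] at hr
      rw [ih _ ?_ (restrictRel P r) rfl]
      obtain ⟨x, y, hxy, hr'⟩ : ∃ x y, P.le x y ∧ ¬ r x y := by
        by_contra! hle
        exact hr.1 (le_antisymm hr.2.le_comp (comp_le hle))
      have hlt : {p : A × A | P.le p.1 p.2 ∧ r p.1 p.2} ⊂ {p : A × A | P.le p.1 p.2} :=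
        ⟨fun p hp => hp.1, fun hsub => hr' (hsub (a := (x, y)) hxy).2⟩
      exact Set.ncard_lt_ncard hlt (Set.toFinite _)

end Inverse

/-! ### The characters `α` and `α^str`, and the inverse of `α`. -/

section Characters

variable (K : Type u) [Field K] [CharZero K]

/-- `ehr` as an algebra morphism. -/
noncomputable def ehrHom : Hqp K →ₐ[K] K[X] := (exists_ehrHom K).choose

/-- `ehr^str` as an algebra morphism. -/
noncomputable def ehrStrHom : Hqp K →ₐ[K] K[X] := (exists_ehrStrHom K).choose

theorem ehrHom_toLinearMap : (ehrHom K).toLinearMap = ehrMap K := (exists_ehrHom K).choose_spec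

theorem ehrStrHom_toLinearMap : (ehrStrHom K).toLinearMap = ehrStrMap K :=
  (exists_ehrStrHom K).choose_spec

section

variable {A : Type v} [Finite A] (P : Preorder A)

theorem ehrHom_cls : ehrHom K (cls K P) = (ehr P).map (algebraMap ℚ K) := by
  rw [← AlgHom.toLinearMap_apply, ehrHom_toLinearMap, ehrMap_cls]

theorem ehrStrHom_cls : ehrStrHom K (cls K P) = (ehrStr P).map (algebraMap ℚ K) := by
  rw [← AlgHom.toLinearMap_apply, ehrStrHom_toLinearMap, ehrStrMap_cls]

theorem ehrHom_cls_eval_zero [Nonempty A] : (ehrHom K (cls K P)).eval 0 = 0 := by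
  rw [ehrHom_cls, eval_zero_map, ehr_eval_zero, map_zero]

theorem ehrStrHom_cls_eval_zero [Nonempty A] : (ehrStrHom K (cls K P)).eval 0 = 0 := by
  rw [ehrStrHom_cls, eval_zero_map, ehrStr_eval_zero, map_zero]

open Classical in
theorem ehrStrHom_cls_eval_one :
    (ehrStrHom K (cls K P)).eval 1 = if IsDiscrete P then 1 else 0 := by
  rw [ehrStrHom_cls, eval_one_map, ehrStr_eval_one]
  split_ifs <;> simp

open Classical in
theorem ehrHom_cls_eval_neg_one :
    (ehrHom K (cls K P)).eval (-1) = if IsDiscrete P then (-1) ^ cl P else 0 := by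
  have h := eval_map_apply (algebraMap ℚ K) (p := ehr P) (-1)
  rw [map_neg, map_one] at h
  rw [ehrHom_cls, h, ehr_eval_neg_one]
  split_ifs <;> simp

end

/-- The character `α`. -/
noncomputable def alpha : Mqp K :=
  lowestCoeff (ehrHom K) (eval_zero_eq_eps fun _ _ _ P => ehrHom_cls_eval_zero K P)

/-- The character `α^str`. -/
noncomputable def alphaStr : Mqp K :=
  lowestCoeff (ehrStrHom K) (eval_zero_eq_eps fun _ _ _ P => ehrStrHom_cls_eval_zero K P)

theorem isComultiplicative_ehrStrHom :
    IsComultiplicative fun (_ : Type v) _ P => ehrStrHom K (cls K P) := by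
  have := isComultiplicative_ehrStrMap.{u, v} K
  rwa [← ehrStrHom_toLinearMap] at this

theorem ehrMap_eq_act_iff (χ : Mqp K) : ehrMap K = act (phiZero K) χ ↔ χ = alpha K := by
  have := isComultiplicative_ehrMap.{u, 0} K
  rw [← ehrHom_toLinearMap] at this ⊢
  exact toLinearMap_eq_act_phiZero_iff _ this χ

theorem ehrStrMap_eq_act_iff (χ : Mqp K) : ehrStrMap K = act (phiZero K) χ ↔ χ = alphaStr K := by
  rw [← ehrStrHom_toLinearMap]
  exact toLinearMap_eq_act_phiZero_iff _ (isComultiplicative_ehrStrHom K) χ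

theorem alphaStr_cls {A : Type v} [Finite A] (P : Preorder A) :
    alphaStr K (cls K P) = (ehrStrHom K (cls K P)).coeff (cc P) := lowestCoeff_cls _ P

theorem coeff_comp_neg_X {R : Type*} [CommRing R] (p : R[X]) (n : ℕ) :
    (p.comp (-X)).coeff n = (-1) ^ n * p.coeff n := by
  rw [show (-X : R[X]) = C (-1) * X by simp, comp_C_mul_X_coeff, mul_comm]

/-- Duality is read at the coefficient of `X ^ cc P`, where substituting `-X` contributes `(-1) ^ cc
P`. -/
theorem alpha_cls {A : Type v} [Finite A] (P : Preorder A) :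
    alpha K (cls K P) = (-1) ^ (cl P + cc P) * alphaStr K (cls K P) := by
  rw [alphaStr_cls, alpha, lowestCoeff_cls, ehrHom_cls, ehrStrHom_cls, coeff_map, coeff_map,
    ehrStr_eq_ehr_comp_neg,
    show ((-1 : ℚ[X]) ^ cl P) = C ((-1) ^ cl P) by simp, coeff_C_mul, coeff_comp_neg_X, map_mul,
    map_mul]
  simp only [map_pow, map_neg, map_one]
  have h (n : ℕ) : (-1 : K) ^ n * (-1) ^ n = 1 := by
    rw [← mul_pow]
    norm_num
  rw [← mul_assoc, ← mul_assoc, pow_add, mul_assoc ((-1 : K) ^ cl P * _),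
    mul_mul_mul_comm, h, h, mul_one, one_mul]

/-- For discrete `P` the sum for `φ₀ ← α` has a single term `α_P X^cl(P)`, to be compared with the
value `(-1)^cl(P)` of `ehr_P` at `-1`. -/
theorem alpha_of_isDiscrete {A : Type v} [Finite A] {P : Preorder A} (h : IsDiscrete P) :
    alpha K (cls K P) = 1 := by
  have h1 := ehrHom_cls_eval_neg_one K P
  have h2 : ehrHom K (cls K P) = act (phiZero K) (alpha K) (cls K P) := by
    rw [← (ehrMap_eq_act_iff K _).2 rfl, ← ehrHom_toLinearMap, AlgHom.toLinearMap_apply]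
  rw [h2, if_pos h, act_cls, compatibles_of_isDiscrete h, Finset.sum_singleton,
    restrictRel_comp, phiZero_cls, lamHom_of_isDiscrete K (isDiscrete_contract_comp P),
    (compatible_comp P).cl_contract, ← cc_eq, h.cc_eq_cl] at h1
  simpa using h1

/-- Both sides are comultiplicative, so values at 0 and 1 suffice. At 1 the strict polynomial of `P
/ r` vanishes unless `P / r` is discrete, which leaves the component relation alone and the value
`λ_P`. -/
theorem act_ehrStrHom_lamHom : act (ehrStrHom K) (lamHom K) = (phiZero K).toLinearMap := by
  classical
  refine linearMap_ext fun n P => (isComultiplicative_act (lamHom K)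
    (isComultiplicative_ehrStrHom K)).eq_of_eval_one (isComultiplicative_phiZero K)
      (fun A _ P => ?_) (fun A _ P => ?_) (Fin n) P
  · rcases isEmpty_or_nonempty A with h | h
    · rw [cls_of_isEmpty, act_one, map_one]
    · rw [act_cls, eval_finsetSum, phiZero_cls]
      simp [ehrStrHom_cls_eval_zero, (cl_pos P).ne']
  · rw [act_cls, eval_finsetSum, Finset.sum_eq_single (comp P)]
    · rw [restrictRel_comp, eval_mul, ehrStrHom_cls_eval_one,
        if_pos (isDiscrete_contract_comp P), phiZero_cls]
      simp
    · intro r hr h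
      rw [eval_mul, ehrStrHom_cls_eval_one,
        if_neg fun hd => h ((mem_compatibles.1 hr).eq_comp_of_isDiscrete hd), mul_zero]
    · exact fun h => (h (mem_compatibles.2 (compatible_comp P))).elim

/-- Up to the factor `(-1) ^ cc`, `β` is `φ₀` evaluated at `-1`. As `P / r` has the same components
as `P`, this factor comes out of the sum, leaving `φ₀ ← α = ehr` at `-1`. -/
theorem conv_betaHom_alpha : conv (betaHom K) (alpha K) = eps' K := by
  classical
  refine linearMap_ext fun n P => ?_
  have h1 := ehrHom_cls_eval_neg_one K P
  have h2 : ehrHom K (cls K P) = act (phiZero K) (alpha K) (cls K P) := by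
    rw [← (ehrMap_eq_act_iff K _).2 rfl, ← ehrHom_toLinearMap, AlgHom.toLinearMap_apply]
  have h3 : conv (betaHom K) (alpha K) (cls K P) =
      (-1) ^ cc P * (ehrHom K (cls K P)).eval (-1) := by
    rw [h2, conv_cls, act_cls, eval_finsetSum, Finset.mul_sum]
    refine Finset.sum_congr rfl fun r hr => ?_
    rw [betaHom_cls, phiZero_cls, (mem_compatibles.1 hr).cc_contract]
    simp only [eval_mul, eval_C, eval_pow, eval_X]
    ring
  rw [h3, h1, eps'_cls]
  split_ifs with h
  · rw [← pow_add, add_comm, neg_one_pow_cl_add_cc h]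
  · rw [mul_zero]

/-- After writing `α` through `α^str`, the signs combine to `(-1)^(cl(P) + cc(P))` and the sum
becomes the coefficient of `X^cc(P)` in `ehr^str ← λ = φ₀`. That monomial has degree `cl(P)`, so the
coefficient vanishes unless `P` is discrete. -/
theorem conv_alpha_betaHom : conv (alpha K) (betaHom K) = eps' K := by
  classical
  refine linearMap_ext fun n P => ?_
  have h1 : conv (alpha K) (betaHom K) (cls K P) =
      (-1) ^ (cl P + cc P) * (phiZero K (cls K P)).coeff (cc P) := by
    rw [← AlgHom.toLinearMap_apply, ← act_ehrStrHom_lamHom, conv_cls, act_cls, finsetSum_coeff,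
      Finset.mul_sum]
    refine Finset.sum_congr rfl fun r hr => ?_
    have hr := mem_compatibles.1 hr
    rw [betaHom_cls, alpha_cls, alphaStr_cls, hr.cc_contract, hr.cl_contract, hr.cc_restrictRel,
      hr.cl_restrictRel, coeff_C_mul]
    -- The number of classes of `r` enters twice, as `cl (P / r)` and as `cc (P | r)`, so its sign
    -- cancels.
    have h2 : (-1 : K) ^ Nat.card (Quotient r) * (-1) ^ Nat.card (Quotient r) = 1 := by
      rw [← mul_pow]
      norm_num
    linear_combination ((-1) ^ (cl P + cc P) * lamHom K (cls K (restrictRel P r)) *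
      (ehrStrHom K (cls K (contract P r))).coeff (cc P)) * h2
  rw [h1, eps'_cls, phiZero_cls, coeff_C_mul, coeff_X_pow]
  simp only [← isDiscrete_iff]
  split_ifs with h
  · rw [neg_one_pow_cl_add_cc h, lamHom_of_isDiscrete K h, mul_one, mul_one]
  · rw [mul_zero, mul_zero]

/-- Uniqueness uses left cancellation by `α`, which is 1 on discrete quasi-posets; associativity of
convolution plays no part. -/
theorem isInverse_alpha_iff (χ : Mqp K) : IsInverse (alpha K) χ ↔ χ = betaHom K := by
  constructor
  · intro h
    refine eq_of_conv_eq (α := alpha K) (fun A _ P hP => ?_)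
      (h.1.trans (conv_alpha_betaHom K).symm)
    rw [alpha_of_isDiscrete K hP]
    exact one_ne_zero
  · rintro rfl
    exact ⟨conv_alpha_betaHom K, conv_betaHom_alpha K⟩

theorem phiZero_cls_iff (χ : Mqp K) :
    (∀ (n : ℕ) (P : Preorder (Fin n)),
      phiZero K (cls K P) = C (χ (cls K P)) * X ^ cl P) ↔ χ = lamHom K := by
  constructor
  · intro h
    refine algHom_ext_cls fun n P => ?_
    have := congrArg (eval 1) ((h n P).symm.trans (phiZero_cls K P))
    simpa using this
  · rintro rfl n P
    exact phiZero_cls K P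

end Characters

end QuasiPoset

open QuasiPoset in
theorem theorem38 (K : Type u) [Field K] [CharZero K] :
    -- the duality principle
    (∀ (A : Type v) [Finite A] (P : Preorder A),
      ehrStr P = (-1) ^ cl P * (ehr P).comp (-X)) ∧
    -- `φ₀`, `λ`, `α`, `α^str` are defined by their characterizations
    ∃ (φ₀ : Hqp K →ₐ[K] K[X]) (lam α αStr : Mqp K),
      (∀ φ : Hqp K →ₐ[K] K[X], IsPhiZero φ ↔ φ = φ₀) ∧
      (∀ χ : Mqp K,
        (∀ (n : ℕ) (P : Preorder (Fin n)), φ₀ (cls K P) = C (χ (cls K P)) * X ^ cl P) ↔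
          χ = lam) ∧
      (∀ χ : Mqp K, ehrMap K = act φ₀ χ ↔ χ = α) ∧
      (∀ χ : Mqp K, ehrStrMap K = act φ₀ χ ↔ χ = αStr) ∧
      -- comparison of `α` and `α^str`
      (∀ (A : Type v) [Finite A] (P : Preorder A),
        α (cls K P) = (-1) ^ (cl P + cc P) * αStr (cls K P)) ∧
      -- `α` is invertible in `M_qp`, and its inverse is `β`
      ∃ β : Mqp K, (∀ χ : Mqp K, IsInverse α χ ↔ χ = β) ∧
        ∀ (A : Type v) [Finite A] (P : Preorder A),
          β (cls K P) = (-1) ^ (cl P + cc P) * lam (cls K P) ∧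
          β (cls K P) =
            (-1) ^ (cl P + cc P) * ((heapOrderings P : K) / ((cl P).factorial : K))
  := by
  refine ⟨fun A _ P => ehrStr_eq_ehr_comp_neg P, phiZero K, lamHom K, alpha K, alphaStr K,
    fun φ => ⟨fun h => h.unique (isPhiZero_phiZero K), fun h => h ▸ isPhiZero_phiZero K⟩,
    phiZero_cls_iff K, ehrMap_eq_act_iff K, ehrStrMap_eq_act_iff K, fun A _ P => alpha_cls K P,
    betaHom K, isInverse_alpha_iff K, fun A _ P => ⟨betaHom_cls K P, ?_⟩⟩
  rw [betaHom_cls, lamHom_cls]
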